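/- Let $\Gamma_0^*(7) = \Gamma_0(7) \cup \Gamma_0(7) W_7 \subset \mathrm{SL}_2(\mathbb{R})$, where $W_7 = \begin{pmatrix} 0 & -1/\sqrt{7} \\ \sqrt{7} & 0 \end{pmatrix}$, acting on the upper half plane $\mathbb{H}$ by Möbius transformations. Let $k$ be an integer and let $f$ be a modular function of weight $k$ for $\Gamma_0^*(7)$: a meromorphic function on $\mathbb{H}$ with $f\left(\frac{az+b}{cz+d}\right) = (cz+d)^k f(z)$ for all $\begin{pmatrix} a & b \\ c & d \end{pmatrix} \in \Gamma_0^*(7)$, which is meromorphic at $\infty$, that is, $f(z) = \tilde f(e^{2\pi i z})$ with $\tilde f$ meromorphic at $0$. For $p \in \mathbb{H}$ let $v_p(f)$ be the order of $f$ at $p$, and let $v_\infty(f)$ be the order of $\tilde f$ at $0$. Put $\rho_{7,1} = -\frac12 + \frac{i}{2\sqrt7}$ and $\rho_{7,2} = -\frac{5}{14} + \frac{\sqrt3\, i}{14}$. If $f$ is not identically zero, then all these orders are finite, $v_p(f)$ depends only on the orbit of $p$ under $\Gamma_0^*(7)$, it is nonzero for only finitely many orbits, and $$v_\infty(f) + \frac12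 v_{i/\sqrt7}(f) + \frac12 v_{\rho_{7,1}}(f) + \frac13 v_{\rho_{7,2}}(f) + \sum_{\substack{p \in \Gamma_0^*(7)\backslash\mathbb{H} \\ p \ne i/\sqrt7,\ \rho_{7,1},\ \rho_{7,2}}} v_p(f) = \frac{k}{3},$$ where the sum runs over the orbits other than those of $i/\sqrt7$, $\rho_{7,1}$ and $\rho_{7,2}$. -/

import Mathlib

open UpperHalfPlane Filter
open scoped MatrixGroups

namespace Fricke

/-- The Fricke involution matrix `W_p`, with rows `(0, -1/√p)` and `(√p, 0)`, in `SL(2, ℝ)`. -/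
noncomputable def W (p : ℕ) [hp : Fact p.Prime] : SL(2, ℝ) :=
  ⟨!![0, -(1 / √(p : ℝ)); √(p : ℝ), 0], by
    have h : √(p : ℝ) ≠ 0 := Real.sqrt_ne_zero'.2 (Nat.cast_pos.2 hp.out.pos)
    simp [Matrix.det_fin_two_of, h]⟩

/-- The image of `Γ₀(p)` in `SL(2, ℝ)`. -/
def Gamma0R (p : ℕ) : Subgroup SL(2, ℝ) :=
  (CongruenceSubgroup.Gamma0 p).map (Matrix.SpecialLinearGroup.map (Int.castRingHom ℝ))

theorem coe_W (p : ℕ) [Fact p.Prime] :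
    (W p : Matrix (Fin 2) (Fin 2) ℝ) = !![0, -(1 / √(p : ℝ)); √(p : ℝ), 0] := rfl

theorem W_mul_W (p : ℕ) [hp : Fact p.Prime] : W p * W p = -1 := by
  have h : √(p : ℝ) ≠ 0 := Real.sqrt_ne_zero'.2 (Nat.cast_pos.2 hp.out.pos)
  ext i j
  fin_cases i <;> fin_cases j <;> simp [coe_W, h]

theorem neg_one_mem_Gamma0R (p : ℕ) : (-1 : SL(2, ℝ)) ∈ Gamma0R p := by
  refine ⟨-1, by simp, ?_⟩
  ext i j
  fin_cases i <;> fin_cases j <;> simp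

/-- `W_p` normalizes `Γ₀(p)`. -/
theorem W_mul_Gamma0R (p : ℕ) [hp : Fact p.Prime] {g : SL(2, ℝ)} (hg : g ∈ Gamma0R p) :
    ∃ g' ∈ Gamma0R p, W p * g = g' * W p := by
  obtain ⟨γ, hγ, rfl⟩ := hg
  have hp0 : (0 : ℝ) < p := Nat.cast_pos.2 hp.out.pos
  have h : √(p : ℝ) ≠ 0 := Real.sqrt_ne_zero'.2 hp0
  obtain ⟨c, hc⟩ : (p : ℤ) ∣ γ 1 0 := (ZMod.intCast_zmod_eq_zero_iff_dvd _ _).1 hγ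
  have hdet : γ 0 0 * γ 1 1 - γ 0 1 * γ 1 0 = 1 := by
    rw [← Matrix.det_fin_two]; exact γ.det_coe
  have hcR : ((γ 1 0 : ℤ) : ℝ) = p * c := by rw [hc]; push_cast; ring
  obtain ⟨δ, hδ⟩ : ∃ δ : SL(2, ℤ),
      (δ : Matrix (Fin 2) (Fin 2) ℤ) = !![γ 1 1, -c; -(p * γ 0 1), γ 0 0] := by
    refine ⟨⟨_, ?_⟩, rfl⟩
    rw [Matrix.det_fin_two_of]
    rw [hc] at hdet
    linear_combination hdet
  refine ⟨_, ⟨δ, ?_, rfl⟩, ?_⟩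
  · change ((δ 1 0 : ℤ) : ZMod p) = 0
    simp [hδ]
  · ext i j
    fin_cases i <;> fin_cases j <;>
      simp [coe_W, Matrix.mul_apply, Fin.sum_univ_two, hcR, hδ] <;> field_simp <;>
      rw [Real.sq_sqrt hp0.le] <;> ring

/-- The Fricke group `Γ₀*(p) = Γ₀(p) ∪ Γ₀(p) W_p`, as a subgroup of `SL(2, ℝ)`. -/
noncomputable def frickeGroup (p : ℕ) [Fact p.Prime] : Subgroup SL(2, ℝ) where
  carrier := {g | g ∈ Gamma0R p ∨ ∃ γ ∈ Gamma0R p, g = γ * W p}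
  one_mem' := Or.inl (one_mem _)
  mul_mem' := by
    rintro a b (ha | ⟨γ, hγ, rfl⟩) (hb | ⟨δ, hδ, rfl⟩)
    · exact Or.inl (mul_mem ha hb)
    · exact Or.inr ⟨a * δ, mul_mem ha hδ, (mul_assoc _ _ _).symm⟩
    · obtain ⟨b', hb', h⟩ := W_mul_Gamma0R p hb
      exact Or.inr ⟨γ * b', mul_mem hγ hb', by rw [mul_assoc, h, mul_assoc]⟩
    · obtain ⟨δ', hδ', h⟩ := W_mul_Gamma0R p hδ
      refine Or.inl ?_
      have : γ * W p * (δ * W p) = γ * δ' * -1 := by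
        rw [← W_mul_W p, mul_assoc, ← mul_assoc (W p), h]
        simp only [mul_assoc]
      rw [this]
      exact mul_mem (mul_mem hγ hδ') (neg_one_mem_Gamma0R p)
  inv_mem' := by
    rintro a (ha | ⟨γ, hγ, rfl⟩)
    · exact Or.inl (inv_mem ha)
    · obtain ⟨γ', hγ', h⟩ := W_mul_Gamma0R p (inv_mem hγ)
      have hW : (W p)⁻¹ = -1 * W p := by
        refine inv_eq_of_mul_eq_one_left ?_
        rw [mul_assoc, W_mul_W]
        simp
      refine Or.inr ⟨-1 * γ', mul_mem (neg_one_mem_Gamma0R p) hγ', ?_⟩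
      rw [mul_inv_rev, hW, mul_assoc, h, mul_assoc]

/-- The meromorphic normal form, on the upper half plane, of a function `f : ℍ → ℂ`: its removable
singularities are removed and its value at each pole is `0`. -/
noncomputable def normalForm (f : ℍ → ℂ) : ℂ → ℂ :=
  toMeromorphicNFOn (f ∘ ofComplex) upperHalfPlaneSet

/-- The function `f̃` of `q` with `f(z) = f̃(exp(2πiz))` near `q = 0`, for a meromorphic function `f`
of period `1`; its value at `q = 0` is irrelevant here. -/
noncomputable def expansionAtInfty (f : ℍ → ℂ) : ℂ → ℂ :=
  Function.Periodic.cuspFunction 1 (normalForm f)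

/-- `f` is a modular function of weight `k` for `Γ₀*(p)`: it is meromorphic on `ℍ`, it satisfies
`f(γz) = (cz + d)^k f(z)` as an identity of meromorphic functions (that is, off a discrete closed
set, as values at poles are meaningless) for all `γ ∈ Γ₀*(p)`, and it is meromorphic at `∞`, the
only cusp of `Γ₀*(p)` up to equivalence. -/
structure IsModularFunction (p : ℕ) [Fact p.Prime] (k : ℤ) (f : ℍ → ℂ) : Prop where
  meromorphic : MeromorphicOn (f ∘ ofComplex) upperHalfPlaneSet
  transform : ∀ γ ∈ frickeGroup p, ∀ᶠ z in codiscrete ℍ,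
    f (γ • z) = ((γ 1 0 : ℂ) * (z : ℂ) + (γ 1 1 : ℂ)) ^ k * f z
  meromorphic_infty : MeromorphicAt (expansionAtInfty f) 0

/-- The order of `f` at the point `z` of `ℍ` (it is `⊤` iff `f` vanishes identically near `z`). -/
noncomputable def order (f : ℍ → ℂ) (z : ℍ) : WithTop ℤ :=
  meromorphicOrderAt (f ∘ ofComplex) (z : ℂ)

/-- The order of `f` at `∞`: the order at `q = 0` of its expansion in `q`. -/
noncomputable def orderAtInfty (f : ℍ → ℂ) : WithTop ℤ :=
  meromorphicOrderAt (expansionAtInfty f) 0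

/-- The quotient `Γ₀*(p) \ ℍ`. -/
abbrev Orbits (p : ℕ) [Fact p.Prime] : Type := MulAction.orbitRel.Quotient (frickeGroup p) ℍ

/-- The orbit of a point. -/
noncomputable def orbit (p : ℕ) [Fact p.Prime] (z : ℍ) : Orbits p :=
  Quotient.mk (MulAction.orbitRel (frickeGroup p) ℍ) z

/-- The order of `f` along an orbit, as an integer, read off at a point of the orbit. -/
noncomputable def orbitOrder (p : ℕ) [Fact p.Prime] (f : ℍ → ℂ) (P : Orbits p) : ℤ :=
  (order f (Quotient.out P)).untop₀

instance fact_prime_seven : Fact (Nat.Prime 7) := ⟨by norm_num⟩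

/-- The point `i/√7`. -/
noncomputable def pointI : ℍ := ⟨⟨0, 1 / √7⟩, by positivity⟩

/-- The point `ρ_{7,1} = -1/2 + i/(2√7)`. -/
noncomputable def rho1 : ℍ := ⟨⟨-1 / 2, 1 / (2 * √7)⟩, by positivity⟩

/-- The point `ρ_{7,2} = -5/14 + √3 i/14`. -/
noncomputable def rho2 : ℍ := ⟨⟨-5 / 14, √3 / 14⟩, by positivity⟩

end Fricke

/-! ### Zeros minus poles near a point when a small constant is subtracted. -/

open Topology

/-! The weight is removed first. The form Δ(z)Δ(7z) has weight 24 for Γ₀*(7), no zero on ℍ, and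
order 1 + 7 = 8 at ∞. So φ = f²⁴ / (Δ(z)Δ(7z))ᵏ is invariant, and 24 times the valence formula says
that φ has degree 0, where an orbit has weight 2 / |stabilizer|; the 2 accounts for -1, which acts
trivially.

That the degree vanishes is proved without contour integrals. If φ is not constant, the degree of φ
- c is locally constant in c (`IsInvariantPair.eventually_degree_sub_const_eq`), hence constant on
the connected space ℂ. Since φ - c = -c φ (φ⁻¹ - c⁻¹), the degree of φ⁻¹ - c⁻¹ is 0 for every c ≠ 0.
Local constancy for φ⁻¹ near 0 then gives φ⁻¹ degree 0 (`IsInvariantPair.degree_inv_eq_zero`), and φ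
is the inverse of φ⁻¹.

Local constancy comes from a local fact: subtracting a small w changes no order near a pole or near
a point where φ is finite and nonzero, while a zero of order n breaks into n simple zeros
(`exists_nhds_finsum_orderJump_eq_zero`). Counting orbits of stabilizers carries this to the
quotient (`finsum_orbit_div_card_stabilizer`), the q-disc gives the same at the cusp, and what is
left of the fundamental domain is compact.

The weights remain: stabilizers have order 4, 4, 6 at the three special points and 2 off their
orbits. A point of the fundamental domain fixed by an elliptic element gives integers subject to
tight inequalities, with few solutions (`IsReduced.re_norm_of_smul_eq`). -/

theorem eventually_nhds_eventually_nhdsNE {X : Type*} [TopologicalSpace X] [T1Space X] {x : X}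
    {p : X → Prop} (h : ∀ᶠ y in 𝓝[≠] x, p y) : ∀ᶠ x' in 𝓝 x, ∀ᶠ y in 𝓝[≠] x', p y := by
  rw [eventually_nhdsWithin_iff] at h
  filter_upwards [h.eventually_nhds] with x' hx'
  by_cases hx : x' = x
  · subst hx
    exact eventually_nhdsWithin_iff.2 hx'
  · filter_upwards [nhdsWithin_le_nhds hx', nhdsWithin_le_nhds (isOpen_ne.mem_nhds hx)]
      with y hy hy' using hy hy'

/-- At a point where `g` does not vanish, subtracting a small constant does not change the orders of
`g` nearby. -/
theorem eventually_meromorphicOrderAt_sub_const_eq {g : ℂ → ℂ} {z : ℂ} (hg : MeromorphicAt g z)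
    (h : meromorphicOrderAt g z ≤ 0) :
    ∀ᶠ p : ℂ × ℂ in 𝓝 0 ×ˢ 𝓝 z,
      meromorphicOrderAt (fun x ↦ g x - p.1) p.2 = meromorphicOrderAt g p.2 := by
  -- As `g` does not vanish at `z`, its inverse `k` extends analytically, also at a pole. Then `g -
  -- w = (1 - w k) / k`, and `1 - w k` is analytic and nonzero for small `w`.
  set k := toMeromorphicNFAt g⁻¹ z with hk
  have hkg : g⁻¹ =ᶠ[𝓝[≠] z] k := hg.inv.eq_nhdsNE_toMeromorphicNFAt
  have hka : AnalyticAt ℂ k z := by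
    rw [hk, ← hg.inv.meromorphicOrderAt_nonneg_iff_analyticAt_toMeromorphicNFAt,
      meromorphicOrderAt_inv]
    cases h' : meromorphicOrderAt g z with
    | top => simp
    | coe n =>
      rw [h'] at h
      have : n ≤ 0 := by exact_mod_cast h
      have h2 : (0 : ℤ) ≤ -n := by omega
      exact_mod_cast h2
  have hne : ∀ᶠ y in 𝓝[≠] z, g y ≠ 0 := by
    rw [← meromorphicOrderAt_ne_top_iff_eventually_ne_zero hg]
    intro h'
    simp [h'] at h
  have h1 : ∀ᶠ z' in 𝓝 z, ∀ᶠ y in 𝓝[≠] z', g y = (k y)⁻¹ ∧ k y ≠ 0 :=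
    eventually_nhds_eventually_nhdsNE <| by
      filter_upwards [hkg, hne] with y hy hy'
      simp [← hy, hy']
  have h2 : ContinuousAt (fun p : ℂ × ℂ ↦ 1 - p.1 * k p.2) (0, z) := by
    have : ContinuousAt (fun p : ℂ × ℂ ↦ k p.2) (0, z) :=
      ContinuousAt.comp (f := Prod.snd) (x := ((0 : ℂ), z)) hka.continuousAt continuousAt_snd
    fun_prop
  have h3 : ∀ᶠ p : ℂ × ℂ in 𝓝 0 ×ˢ 𝓝 z, 1 - p.1 * k p.2 ≠ 0 := by
    rw [← nhds_prod_eq]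
    exact h2.eventually_ne (by simp)
  filter_upwards [h3, h1.prod_inr (𝓝 (0 : ℂ)), hka.eventually_analyticAt.prod_inr (𝓝 (0 : ℂ))]
    with ⟨w, z'⟩ hp hp1 hp2
  have e1 : (fun x ↦ g x - w) =ᶠ[𝓝[≠] z'] (fun x ↦ 1 - w * k x) * k⁻¹ := by
    filter_upwards [hp1] with y ⟨hy, hy'⟩
    simp only [hy, Pi.mul_apply, Pi.inv_apply]
    field_simp
  have e2 : g =ᶠ[𝓝[≠] z'] k⁻¹ := by
    filter_upwards [hp1] with y ⟨hy, hy'⟩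
    simp [hy]
  dsimp only at hp2 ⊢
  have ha : AnalyticAt ℂ (fun x ↦ 1 - w * k x) z' := by fun_prop
  rw [meromorphicOrderAt_congr e1, meromorphicOrderAt_congr e2,
    meromorphicOrderAt_mul_of_ne_zero ha hp]

/-- Near a zero of order `n`, a meromorphic function is the `n`-th power of a local coordinate. -/
theorem exists_eventuallyEq_pow_of_meromorphicOrderAt {g : ℂ → ℂ} {z : ℂ} (hg : MeromorphicAt g z)
    {n : ℕ} (hn : n ≠ 0) (h : meromorphicOrderAt g z = n) :
    ∃ f : ℂ → ℂ, AnalyticAt ℂ f z ∧ f z = 0 ∧ deriv f z ≠ 0 ∧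
      ∀ᶠ y in 𝓝[≠] z, g y = f y ^ n := by
  obtain ⟨u, hu, hu0, hgu⟩ := (meromorphicOrderAt_eq_int_iff (n := n) hg).1 (by simpa using h)
  obtain ⟨c, hc⟩ : ∃ c : ℂ, c ^ n = u z := IsAlgClosed.exists_pow_nat_eq _ (Nat.pos_of_ne_zero hn)
  have hc0 : c ≠ 0 := by
    rintro rfl
    simp [hn] at hc
    exact hu0 hc.symm
  -- An analytic `n`-th root of `u`: the quotient `u y / u z` is 1 at `z`, hence near the principal
  -- branch's safe point, and `c` restores the constant.
  have hv : AnalyticAt ℂ (fun y ↦ c * (u y / u z) ^ ((n : ℂ)⁻¹)) z := by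
    refine analyticAt_const.mul (AnalyticAt.cpow (hu.div analyticAt_const hu0) analyticAt_const ?_)
    simp [hu0]
  refine ⟨fun y ↦ (y - z) * (c * (u y / u z) ^ ((n : ℂ)⁻¹)), by fun_prop, by simp, ?_, ?_⟩
  · have h1 : HasDerivAt (fun y ↦ (y - z) * (c * (u y / u z) ^ ((n : ℂ)⁻¹)))
        (1 * (c * (u z / u z) ^ ((n : ℂ)⁻¹)) + (z - z) * deriv _ z) z :=
      ((hasDerivAt_id z).sub_const z).mul hv.differentiableAt.hasDerivAt
    rw [h1.deriv]
    simp [hu0, hc0]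
  · filter_upwards [hgu] with y hy
    rw [hy, mul_pow, mul_pow, Complex.cpow_nat_inv_pow _ hn, hc]
    simp [mul_div_cancel₀ _ hu0]

theorem Complex.ncard_setOf_pow_eq {n : ℕ} (hn : n ≠ 0) {w : ℂ} (hw : w ≠ 0) :
    {x : ℂ | x ^ n = w}.ncard = n := by
  obtain ⟨c, hc⟩ : ∃ c : ℂ, c ^ n = w := IsAlgClosed.exists_pow_nat_eq _ (Nat.pos_of_ne_zero hn)
  have hprim := Complex.isPrimitiveRoot_exp n hn
  have h1 := hprim.card_nthRoots w
  rw [if_pos ⟨c, hc⟩] at h1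
  have h2 : {x : ℂ | x ^ n = w} = ↑(Polynomial.nthRoots n w).toFinset := by
    ext x
    simp [Polynomial.mem_nthRoots (Nat.pos_of_ne_zero hn)]
  rw [h2, Set.ncard_coe_finset, Multiset.toFinset_card_of_nodup (hprim.nthRoots_nodup hw), h1]

/-- The change of the order of `g` at `z` on subtracting the constant `w`. -/
noncomputable def orderJump (g : ℂ → ℂ) (w z : ℂ) : ℤ :=
  (meromorphicOrderAt (fun x ↦ g x - w) z).untop₀ - (meromorphicOrderAt g z).untop₀

/-- Local constancy of the number of zeros minus the number of poles: near any point, the orders of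
`g - w` and of `g` have the same sum. -/
theorem exists_nhds_finsum_orderJump_eq_zero {g : ℂ → ℂ} {z : ℂ} (hg : MeromorphicAt g z)
    (h : meromorphicOrderAt g z ≠ ⊤) :
    ∃ U₀ ∈ 𝓝 z, ∀ U ⊆ U₀, U ∈ 𝓝 z → ∀ᶠ w in 𝓝 0,
      (U ∩ Function.support (orderJump g w)).Finite ∧ ∑ᶠ x ∈ U, orderJump g w x = 0 := by
  rcases le_or_gt (meromorphicOrderAt g z) 0 with h0 | h0
  · obtain ⟨s, hs, U₀, hU₀, hsU⟩ :=
      eventually_prod_iff.1 (eventually_meromorphicOrderAt_sub_const_eq hg h0)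
    refine ⟨_, hU₀, fun U hU _ ↦ ?_⟩
    filter_upwards [hs] with w hw
    have h1 : ∀ x ∈ U, orderJump g w x = 0 := fun x hx ↦ by
      have := hsU hw (hU hx)
      simp only at this
      simp [orderJump, this]
    refine ⟨?_, finsum_mem_eq_zero_of_forall_eq_zero h1⟩
    convert Set.finite_empty
    ext x
    simpa using h1 x
  · obtain ⟨n, hn, hn0⟩ : ∃ n : ℕ, meromorphicOrderAt g z = n ∧ n ≠ 0 := by
      lift meromorphicOrderAt g z to ℤ using h with m
      have : 0 < m := by exact_mod_cast h0
      exact ⟨m.toNat, by norm_cast; simp [this.le], by omega⟩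
    -- With `g = f ^ n` and `f` a local coordinate, `f ^ n - w` has a simple zero at each of the `n`
    -- points where `f` is an `n`-th root of `w`; together they replace the zero of order `n` at
    -- `z`.
    obtain ⟨f, hf, hf0, hf', hgf⟩ := exists_eventuallyEq_pow_of_meromorphicOrderAt hg hn0 hn
    have hstrict := hf.hasStrictDerivAt
    set e := HasStrictFDerivAt.toOpenPartialHomeomorph f (hstrict.hasStrictFDerivAt_equiv hf')
    have hsrc : e.source ∈ 𝓝 z :=
      e.open_source.mem_nhds (HasStrictFDerivAt.mem_toOpenPartialHomeomorph_source (hstrict.hasStrictFDerivAt_equiv hf'))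
    have hinj : Set.InjOn f e.source := e.injOn
    have hmap : map f (𝓝 z) = 𝓝 0 := by rw [hstrict.map_nhds_eq hf', hf0]
    have hder : ∀ᶠ y in 𝓝 z, deriv f y ≠ 0 :=
      hf.deriv.continuousAt.eventually_ne hf'
    refine ⟨_, inter_mem hsrc (inter_mem hder (inter_mem hf.eventually_analyticAt
      (eventually_nhds_eventually_nhdsNE hgf))), fun U hU hUz ↦ ?_⟩
    -- If `f '' U` contains the ball of radius `ε`, then `|w| < ε ^ n` puts all `n`-th roots of `w`
    -- in it.
    have hroots : ∀ᶠ w in 𝓝 (0 : ℂ), ∀ x : ℂ, x ^ n = w → x ∈ f '' U := by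
      have : f '' U ∈ 𝓝 (0 : ℂ) := hmap ▸ image_mem_map hUz
      obtain ⟨ε, hε, hball⟩ := Metric.mem_nhds_iff.1 this
      filter_upwards [Metric.ball_mem_nhds (0 : ℂ) (pow_pos hε n)] with w hw x hx
      refine hball ?_
      rw [mem_ball_zero_iff] at hw ⊢
      rw [← hx, norm_pow] at hw
      exact lt_of_pow_lt_pow_left₀ n hε.le hw
    filter_upwards [hroots] with w hw
    rcases eq_or_ne w 0 with rfl | hw0
    · have : orderJump g 0 = 0 := by ext; simp [orderJump]
      simp [this]
    have hzU : z ∈ U := mem_of_mem_nhds hUz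
    set T := {x | x ∈ U ∧ f x ^ n = w} with hT
    have hbij : Set.BijOn f T {x | x ^ n = w} := by
      refine ⟨fun x hx ↦ hx.2, fun x hx y hy hxy ↦ hinj (hU hx.1).1 (hU hy.1).1 hxy, ?_⟩
      rintro x hx
      obtain ⟨y, hy, rfl⟩ := hw x hx
      exact ⟨y, ⟨hy, hx⟩, rfl⟩
    have hTcard : T.ncard = n := by
      rw [← Complex.ncard_setOf_pow_eq hn0 hw0, ← hbij.image_eq, hbij.injOn.ncard_image]
    have hTfin : T.Finite := Set.finite_of_ncard_ne_zero (hTcard ▸ hn0)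
    have hjump : ∀ x ∈ U, orderJump g w x =
        Set.indicator T (fun _ ↦ (1 : ℤ)) x - Set.indicator {z} (fun _ ↦ (n : ℤ)) x := by
      intro x hx
      obtain ⟨hxs, hxd, hxa, hxg⟩ := hU hx
      have e1 : meromorphicOrderAt (fun y ↦ g y - w) x =
          meromorphicOrderAt (fun y ↦ f y ^ n - w) x :=
        meromorphicOrderAt_congr (by filter_upwards [hxg] with y hy; rw [hy])
      have e2 : (meromorphicOrderAt g x).untop₀ = Set.indicator {z} (fun _ ↦ (n : ℤ)) x := by
        by_cases hxz : x = z
        · subst hxz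
          simp [hn]
        · have hfx : f x ≠ 0 := fun h0 ↦ hxz (hinj hxs (hU hzU).1 (h0.trans hf0.symm))
          rw [meromorphicOrderAt_congr hxg]
          have : AnalyticAt ℂ (fun y ↦ f y ^ n) x := hxa.pow n
          rw [this.meromorphicOrderAt_eq,
            (this.analyticOrderAt_eq_zero).2 (pow_ne_zero n hfx)]
          simp [hxz]
      have ha : AnalyticAt ℂ (fun y ↦ f y ^ n - w) x := (hxa.pow n).sub analyticAt_const
      have e3 : (meromorphicOrderAt (fun y ↦ f y ^ n - w) x).untop₀ =
          Set.indicator T (fun _ ↦ (1 : ℤ)) x := by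
        by_cases hxT : f x ^ n = w
        · have hfx : f x ≠ 0 := by
            intro h0
            rw [h0, zero_pow hn0] at hxT
            exact hw0 hxT.symm
          have hd : deriv (fun y ↦ f y ^ n - w) x ≠ 0 := by
            have hd1 : HasDerivAt (fun y ↦ f y ^ n - w) (n * f x ^ (n - 1) * deriv f x) x :=
              (hxa.differentiableAt.hasDerivAt.pow n).sub_const w
            rw [hd1.deriv]
            exact mul_ne_zero (mul_ne_zero (by simpa using hn0) (pow_ne_zero _ hfx)) hxd
          have : analyticOrderAt (fun y ↦ f y ^ n - w) x = 1 := by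
            have := ha.analyticOrderAt_sub_eq_one_of_deriv_ne_zero hd
            simpa [hxT] using this
          rw [ha.meromorphicOrderAt_eq, this, Set.indicator_of_mem (show x ∈ T from ⟨hx, hxT⟩)]
          rfl
        · rw [ha.meromorphicOrderAt_eq, ha.analyticOrderAt_eq_zero.2 (sub_ne_zero.2 hxT),
            Set.indicator_of_notMem (fun hh ↦ hxT hh.2)]
          simp
      rw [orderJump, e1, e2, e3]
    have hsupp : U ∩ Function.support (orderJump g w) ⊆ T ∪ {z} := by
      rintro x ⟨hx, hx'⟩
      by_contra hcon
      simp only [Set.mem_union, not_or] at hcon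
      apply hx'
      rw [hjump x hx, Set.indicator_of_notMem hcon.1, Set.indicator_of_notMem hcon.2, sub_zero]
    refine ⟨(hTfin.union (Set.finite_singleton z)).subset hsupp, ?_⟩
    have hsub : T ∪ {z} ⊆ U := Set.union_subset (fun x hx ↦ hx.1) (by simpa using hzU)
    have hTU : hTfin.toFinset ⊆ hTfin.toFinset ∪ {z} := Finset.subset_union_left
    have hzU' : {z} ⊆ hTfin.toFinset ∪ {z} := Finset.subset_union_right
    have s1 := Finset.sum_indicator_subset (fun _ ↦ (1 : ℤ)) hTU
    have s2 := Finset.sum_indicator_subset (fun _ ↦ (n : ℤ)) hzU'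
    rw [Set.Finite.coe_toFinset] at s1
    rw [Finset.coe_singleton] at s2
    rw [finsum_mem_eq_sum_of_inter_support_eq (t := hTfin.toFinset ∪ {z}),
      Finset.sum_congr rfl (fun x hx ↦ hjump x (hsub (by simpa using hx))),
      Finset.sum_sub_distrib, s1, s2]
    · simp [← Set.ncard_eq_toFinset_card _ hTfin, hTcard]
    · refine Set.Subset.antisymm (fun x hx ↦ ⟨by simpa using hsupp hx, hx.2⟩)
        (fun x hx ↦ ⟨hsub (by simpa using hx.1), hx.2⟩)

/-! ### The group Γ₀*(7) and its action on ℍ. -/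

namespace Fricke

theorem coe_smul_eq (γ : SL(2, ℝ)) (z : ℍ) :
    ((γ • z : ℍ) : ℂ) = ((γ 0 0 : ℂ) * z + (γ 0 1 : ℂ)) / ((γ 1 0 : ℂ) * z + (γ 1 1 : ℂ)) := by
  simpa using coe_specialLinearGroup_apply γ z

theorem det_eq (γ : SL(2, ℝ)) : γ 0 0 * γ 1 1 - γ 0 1 * γ 1 0 = 1 := by
  rw [← Matrix.det_fin_two]
  exact γ.det_coe

theorem denom_ne_zero (γ : SL(2, ℝ)) (z : ℍ) : (γ 1 0 : ℂ) * z + (γ 1 1 : ℂ) ≠ 0 := by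
  intro h
  have him := congrArg Complex.im h
  have hre := congrArg Complex.re h
  simp [z.im_ne_zero] at him
  simp [him] at hre
  have := det_eq γ
  simp [him, hre] at this

theorem im_smul_eq (γ : SL(2, ℝ)) (z : ℍ) :
    (γ • z).im = z.im / ((γ 1 0 * z.re + γ 1 1) ^ 2 + (γ 1 0 * z.im) ^ 2) := by
  have h := congrArg Complex.im (coe_smul_eq γ z)
  rw [coe_im, Complex.div_im] at h
  have hns : Complex.normSq ((γ 1 0 : ℂ) * z + (γ 1 1 : ℂ)) =
      (γ 1 0 * z.re + γ 1 1) ^ 2 + (γ 1 0 * z.im) ^ 2 := by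
    simp [Complex.normSq_apply]
    ring
  rw [h, hns, ← sub_div]
  congr 1
  simp
  linear_combination z.im * det_eq γ

/-- These are the sum and the product of the roots z, z̄ of the fixed point equation c z² + (d - a)
z - b = 0. -/
theorem smul_eq_self_iff (γ : SL(2, ℝ)) (z : ℍ) :
    γ • z = z ↔ γ 1 1 - γ 0 0 = -2 * z.re * γ 1 0 ∧ γ 0 1 = -γ 1 0 * (z.re ^ 2 + z.im ^ 2) := by
  rw [UpperHalfPlane.ext_iff, coe_smul_eq, div_eq_iff (denom_ne_zero γ z), Complex.ext_iff]
  have hz := z.im_ne_zero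
  simp only [Complex.add_re, Complex.mul_re, Complex.ofReal_re, Complex.ofReal_im, coe_re, coe_im,
    Complex.add_im, Complex.mul_im, zero_mul, sub_zero, add_zero]
  constructor
  · rintro ⟨h1, h2⟩
    have h3 : γ 1 1 - γ 0 0 = -2 * z.re * γ 1 0 := by
      apply mul_left_cancel₀ hz
      linear_combination -h2
    exact ⟨h3, by linear_combination h1 + z.re * h3⟩
  · rintro ⟨h1, h2⟩
    exact ⟨by linear_combination h2 - z.re * h1, by linear_combination -z.im * h1⟩

theorem sqrt_seven_ne_zero : √(7 : ℝ) ≠ 0 := by positivity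

theorem sqrt_seven_mul_self : √(7 : ℝ) * √7 = 7 := Real.mul_self_sqrt (by norm_num)

/-- The elements of `Γ₀*(7)`. -/
theorem mem_frickeGroup_seven_iff {γ : SL(2, ℝ)} : γ ∈ frickeGroup 7 ↔
    (∃ a b c d : ℤ, a * d - 7 * b * c = 1 ∧
      γ 0 0 = a ∧ γ 0 1 = b ∧ γ 1 0 = 7 * c ∧ γ 1 1 = d) ∨
    ∃ a b c d : ℤ, 7 * a * d - b * c = 1 ∧
      γ 0 0 = √7 * a ∧ γ 0 1 = b / √7 ∧ γ 1 0 = √7 * c ∧ γ 1 1 = √7 * d := by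
  have hG : ∀ γ : SL(2, ℝ), γ ∈ Gamma0R 7 ↔ ∃ a b c d : ℤ, a * d - 7 * b * c = 1 ∧
      γ 0 0 = a ∧ γ 0 1 = b ∧ γ 1 0 = 7 * c ∧ γ 1 1 = d := by
    intro γ
    constructor
    · rintro ⟨g, hg, rfl⟩
      obtain ⟨c, hc⟩ : ((7 : ℕ) : ℤ) ∣ g 1 0 := (ZMod.intCast_zmod_eq_zero_iff_dvd _ _).1 hg
      have hdet : g 0 0 * g 1 1 - g 0 1 * g 1 0 = 1 := by
        rw [← Matrix.det_fin_two]; exact g.det_coe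
      rw [hc] at hdet
      refine ⟨g 0 0, g 0 1, c, g 1 1, by push_cast at hdet; linear_combination hdet, ?_⟩
      simp [hc]
    · rintro ⟨a, b, c, d, h, h1, h2, h3, h4⟩
      obtain ⟨δ, hδ⟩ : ∃ δ : SL(2, ℤ),
          (δ : Matrix (Fin 2) (Fin 2) ℤ) = !![a, b; 7 * c, d] := by
        refine ⟨⟨_, ?_⟩, rfl⟩
        rw [Matrix.det_fin_two_of]
        linear_combination h
      refine ⟨δ, ?_, ?_⟩
      · change ((δ 1 0 : ℤ) : ZMod 7) = 0
        have : (7 : ZMod 7) = 0 := rfl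
        simp [hδ, this]
      · ext i j
        fin_cases i <;> fin_cases j <;> simp [hδ, h1, h2, h3, h4]
  have h7 := sqrt_seven_ne_zero
  have h77 := sqrt_seven_mul_self
  have hW : ∀ γ : SL(2, ℝ), (γ * W 7) 0 0 = √7 * γ 0 1 ∧ (γ * W 7) 0 1 = -γ 0 0 / √7 ∧
      (γ * W 7) 1 0 = √7 * γ 1 1 ∧ (γ * W 7) 1 1 = -γ 1 0 / √7 := by
    intro γ
    simp [coe_W, Matrix.mul_apply, Fin.sum_univ_two]
    refine ⟨?_, ?_, ?_, ?_⟩ <;> ring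
  constructor
  · rintro (h | ⟨g, hg, rfl⟩)
    · exact Or.inl ((hG _).1 h)
    · obtain ⟨a, b, c, d, h, h1, h2, h3, h4⟩ := (hG _).1 hg
      obtain ⟨w1, w2, w3, w4⟩ := hW g
      refine Or.inr ⟨b, -a, d, -c, by linear_combination h, ?_, ?_, ?_, ?_⟩
      · rw [w1, h2]
      · rw [w2, h1]; push_cast; rfl
      · rw [w3, h4]
      · rw [w4, h3]
        push_cast
        field_simp
        linear_combination (c : ℝ) * h77
  · rintro (h | ⟨a, b, c, d, h, h1, h2, h3, h4⟩)
    · exact Or.inl ((hG _).2 h)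
    · have hR : (7 : ℝ) * a * d - b * c = 1 := by exact_mod_cast h
      -- This is `γ * (W 7)⁻¹`.
      let g : SL(2, ℝ) := ⟨!![-b, a; -7 * d, c], by
        rw [Matrix.det_fin_two_of]; linear_combination hR⟩
      refine Or.inr ⟨g, (hG _).2 ⟨-b, a, -d, c, by linear_combination h, ?_, ?_, ?_, ?_⟩, ?_⟩
      · simp [g]
      · simp [g]
      · simp [g]
      · simp [g]
      · obtain ⟨w1, w2, w3, w4⟩ := hW g
        ext i j
        fin_cases i <;> fin_cases j
        · exact h1.trans (w1.trans (by simp [g])).symm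
        · exact h2.trans (w2.trans (by simp [g])).symm
        · exact h3.trans (w3.trans (by simp [g])).symm
        · refine h4.trans (w4.trans ?_).symm
          simp [g]
          field_simp
          linear_combination -(d : ℝ) * h77

theorem neg_one_mem_frickeGroup : (-1 : SL(2, ℝ)) ∈ frickeGroup 7 :=
  Or.inl (neg_one_mem_Gamma0R 7)

theorem W_mem_frickeGroup : W 7 ∈ frickeGroup 7 := Or.inr ⟨1, one_mem _, (one_mul _).symm⟩

theorem neg_smul_eq (γ : SL(2, ℝ)) (z : ℍ) : (-γ) • z = γ • z := by
  rw [UpperHalfPlane.ext_iff, coe_smul_eq, coe_smul_eq]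
  simp only [Matrix.SpecialLinearGroup.coe_neg, Matrix.neg_apply, Complex.ofReal_neg]
  rw [← neg_div_neg_eq]
  congr 1 <;> ring

/-- The translation by `n`. -/
noncomputable def translation (n : ℤ) : SL(2, ℝ) := ⟨!![1, n; 0, 1], by simp⟩

theorem coe_translation (n : ℤ) :
    (translation n : Matrix (Fin 2) (Fin 2) ℝ) = !![1, (n : ℝ); 0, 1] := rfl

theorem translation_mem (n : ℤ) : translation n ∈ frickeGroup 7 :=
  mem_frickeGroup_seven_iff.2 (Or.inl ⟨1, n, 0, 1, by simp, by simp [coe_translation]⟩)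

theorem coe_translation_smul (n : ℤ) (z : ℍ) : ((translation n • z : ℍ) : ℂ) = z + n := by
  rw [coe_smul_eq]
  simp [coe_translation]

/-- With lower left entry 0 the determinant gives a d = 1 on Γ₀(7), and the impossible 7 a d = 1 on
the other coset. -/
theorem eq_translation_of_apply_eq_zero {γ : SL(2, ℝ)} (hγ : γ ∈ frickeGroup 7) (h : γ 1 0 = 0) :
    ∃ n : ℤ, γ = translation n ∨ γ = -translation n := by
  rcases mem_frickeGroup_seven_iff.1 hγ with ⟨a, b, c, d, h0, h1, h2, h3, h4⟩ |
    ⟨a, b, c, d, h0, h1, h2, h3, h4⟩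
  · have hc : c = 0 := by
      have : (7 : ℝ) * c = 0 := h3 ▸ h
      simpa using this
    subst hc
    have had : a * d = 1 := by linarith
    rcases Int.eq_one_or_neg_one_of_mul_eq_one' had with ⟨rfl, rfl⟩ | ⟨rfl, rfl⟩
    · refine ⟨b, Or.inl ?_⟩
      ext i j
      fin_cases i <;> fin_cases j <;> simp [coe_translation, h1, h2, h3, h4]
    · refine ⟨-b, Or.inr ?_⟩
      ext i j
      fin_cases i <;> fin_cases j <;> simp [coe_translation, h1, h2, h3, h4]
  · exfalso
    have hc : c = 0 := by
      have : √7 * (c : ℝ) = 0 := h3 ▸ h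
      simpa using this
    subst hc
    have : 7 * (a * d) = 1 := by linarith
    omega

theorem seven_le_sq_of_apply_ne_zero {γ : SL(2, ℝ)} (hγ : γ ∈ frickeGroup 7) (h : γ 1 0 ≠ 0) :
    7 ≤ γ 1 0 ^ 2 := by
  rcases mem_frickeGroup_seven_iff.1 hγ with ⟨a, b, c, d, h0, h1, h2, h3, h4⟩ |
    ⟨a, b, c, d, h0, h1, h2, h3, h4⟩
  all_goals
    have hc : c ≠ 0 := by
      rintro rfl
      simp [h3] at h
    have h5 : (1 : ℝ) ≤ (c : ℝ) ^ 2 := by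
      have : 0 < c ^ 2 := by positivity
      exact_mod_cast this
    rw [h3, mul_pow]
  · nlinarith
  · rw [Real.sq_sqrt (by norm_num)]
    nlinarith

/-- Im γz = y / |cz + d|² with |cz + d|² ≥ c² y² ≥ 7 y². -/
theorem im_smul_le {γ : SL(2, ℝ)} (hγ : γ ∈ frickeGroup 7) (h : γ 1 0 ≠ 0) (z : ℍ) :
    (γ • z).im ≤ 1 / (7 * z.im) := by
  have h7 := seven_le_sq_of_apply_ne_zero hγ h
  have hz := z.im_pos
  rw [im_smul_eq, div_le_div_iff₀ (by positivity) (by positivity)]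
  nlinarith [sq_nonneg (γ 1 0 * z.re + γ 1 1), mul_le_mul_of_nonneg_right h7 (sq_nonneg z.im)]

theorem im_smul_of_apply_eq_zero {γ : SL(2, ℝ)} (hγ : γ ∈ frickeGroup 7) (h : γ 1 0 = 0) (z : ℍ) :
    (γ • z).im = z.im := by
  obtain ⟨n, rfl | rfl⟩ := eq_translation_of_apply_eq_zero hγ h
  · rw [← coe_im, coe_translation_smul]; simp
  · rw [neg_smul_eq, ← coe_im, coe_translation_smul]; simp

theorem im_smul_le_max {γ : SL(2, ℝ)} (hγ : γ ∈ frickeGroup 7) (z : ℍ) :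
    (γ • z).im ≤ max z.im (1 / (7 * z.im)) := by
  by_cases h : γ 1 0 = 0
  · exact (im_smul_of_apply_eq_zero hγ h z).le.trans (le_max_left _ _)
  · exact (im_smul_le hγ h z).trans (le_max_right _ _)

theorem isCompact_setOf_re_im (a b : ℝ) (ha : 0 < a) :
    IsCompact {z : ℍ | |z.re| ≤ 1 / 2 ∧ a ≤ z.im ∧ z.im ≤ b} := by
  rw [isOpenEmbedding_coe.isInducing.isCompact_iff]
  convert! (isCompact_Icc (a := (-(1 / 2) : ℝ)) (b := 1 / 2)).reProdIm (isCompact_Icc (a := a) (b := b))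
    using 1
  ext z
  simp only [Set.mem_image, Set.mem_ofPred_eq, Complex.mem_reProdIm, Set.mem_Icc, abs_le]
  constructor
  · rintro ⟨z, hz, rfl⟩
    exact hz
  · intro hz
    exact ⟨⟨z, ha.trans_le hz.2.1⟩, hz, rfl⟩

/-- Γ₀(7) inherits the property from the image of SL(2, ℤ). On the other coset, γW moves K onto L
exactly as γ moves the compact set WK. -/
instance : ProperlyDiscontinuousSMul (frickeGroup 7) ℍ := by
  have hG : ProperlyDiscontinuousSMul (Gamma0R 7) ℍ :=
    Subgroup.properlyDiscontinuousSMul_of_le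
      (H := Gamma0R 7) (G := (Matrix.SpecialLinearGroup.map (Int.castRingHom ℝ)).range) inferInstance
      (Subgroup.map_le_range _ _)
  rw [Subgroup.properlyDiscontinuousSMul_iff] at hG ⊢
  intro K L hK hL
  refine ((hG hK hL).union ((hG (hK.image (continuous_const_smul (W 7))) hL).image
    (· * W 7))).subset ?_
  rintro g ⟨hg | ⟨γ, hγ, rfl⟩, hne⟩
  · exact Or.inl ⟨hg, hne⟩
  · refine Or.inr ⟨γ, ⟨hγ, ?_⟩, rfl⟩
    obtain ⟨_, ⟨x, hx, rfl⟩, hL'⟩ := hne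
    exact ⟨_, ⟨_, ⟨x, hx, rfl⟩, rfl⟩, by simpa [mul_smul] using hL'⟩

theorem exists_translation_re_le (z : ℍ) : ∃ n : ℤ, |(translation n • z).re| ≤ 1 / 2 := by
  refine ⟨-round z.re, ?_⟩
  rw [← coe_re, coe_translation_smul]
  simpa [sub_eq_add_neg] using abs_sub_round z.re

/-- Every orbit has a point of maximal imaginary part in the strip `|Re z| ≤ 1/2`. -/
theorem exists_smul_max_im (z : ℍ) : ∃ γ ∈ frickeGroup 7, |(γ • z).re| ≤ 1 / 2 ∧
    ∀ δ ∈ frickeGroup 7, (δ • γ • z).im ≤ (γ • z).im := by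
  set b := max z.im (1 / (7 * z.im)) with hb
  -- Imaginary parts on the orbit are at most `b`, so the competitors lie in a compact box; only
  -- finitely many group elements bring `z` there, and a maximum is attained.
  have hfin := finite_disjoint_inter_image (Γ := frickeGroup 7) (T := ℍ) (isCompact_singleton (x := z))
    (isCompact_setOf_re_im z.im b z.im_pos)
  set S := {γ : frickeGroup 7 | (((γ • ·) '' {z}) ∩
    {z' : ℍ | |z'.re| ≤ 1 / 2 ∧ z.im ≤ z'.im ∧ z'.im ≤ b}).Nonempty} with hS
  have hmem : ∀ γ : frickeGroup 7, γ ∈ S ↔ |(γ • z).re| ≤ 1 / 2 ∧ z.im ≤ (γ • z).im := by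
    intro γ
    simp only [hS, Set.image_singleton, Set.singleton_inter_nonempty, Set.mem_ofPred_eq]
    exact ⟨fun h ↦ ⟨h.1, h.2.1⟩, fun h ↦ ⟨h.1, h.2, im_smul_le_max γ.2 z⟩⟩
  have hne : S.Nonempty := by
    obtain ⟨n, hn⟩ := exists_translation_re_le z
    refine ⟨⟨_, translation_mem n⟩, (hmem _).2 ⟨hn, ?_⟩⟩
    exact (im_smul_of_apply_eq_zero (translation_mem n) (by simp [coe_translation]) z).ge
  obtain ⟨γ, hγ, hmax⟩ := hfin.exists_maximalFor (fun γ : frickeGroup 7 ↦ (γ • z).im) S hne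
  refine ⟨γ, γ.2, ((hmem _).1 hγ).1, fun δ hδ ↦ ?_⟩
  by_contra! hlt
  obtain ⟨n, hn⟩ := exists_translation_re_le (δ • (γ : SL(2, ℝ)) • z)
  have him := im_smul_of_apply_eq_zero (translation_mem n) (by simp [coe_translation])
    (δ • (γ : SL(2, ℝ)) • z)
  let ε : frickeGroup 7 := ⟨translation n * (δ * γ), mul_mem (translation_mem n) (mul_mem hδ γ.2)⟩
  have hε : ε • z = translation n • δ • (γ : SL(2, ℝ)) • z := by
    change (translation n * (δ * (γ : SL(2, ℝ)))) • z = _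
    rw [mul_smul, mul_smul]
  have h1 : z.im ≤ (γ • z).im := ((hmem _).1 hγ).2
  have hlt' : (γ • z).im < (ε • z).im := by rw [hε, him]; exact hlt
  have hεS : ε ∈ S := (hmem _).2 ⟨by rw [hε]; exact hn, h1.trans hlt'.le⟩
  exact absurd (hmax hεS hlt'.le) (not_le.2 hlt')

/-- The fundamental domain of `Γ₀*(7)`. -/
structure IsReduced (z : ℍ) : Prop where
  re_le : |z.re| ≤ 1 / 2
  one_le : 1 ≤ 7 * (z.re ^ 2 + z.im ^ 2)
  one_le_add : 1 ≤ 28 * ((z.re + 1 / 2) ^ 2 + z.im ^ 2)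
  one_le_sub : 1 ≤ 28 * ((z.re - 1 / 2) ^ 2 + z.im ^ 2)

/-- At a point of maximal imaginary part |cz + d| ≥ 1 for every bottom row of the group. The rows
(√7, 0), (2√7, √7), (2√7, -√7) give the three circles; the top rows only complete the determinant.
-/
theorem exists_smul_isReduced (z : ℍ) : ∃ γ ∈ frickeGroup 7, IsReduced (γ • z) := by
  obtain ⟨γ, hγ, hre, hmax⟩ := exists_smul_max_im z
  refine ⟨γ, hγ, ?_⟩
  have key : ∀ δ ∈ frickeGroup 7,
      1 ≤ (δ 1 0 * (γ • z).re + δ 1 1) ^ 2 + (δ 1 0 * (γ • z).im) ^ 2 := by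
    intro δ hδ
    have h := hmax δ hδ
    have hpos := (γ • z).im_pos
    have hpos' := (δ • γ • z).im_pos
    rw [im_smul_eq] at h hpos'
    have hq : 0 < (δ 1 0 * (γ • z).re + δ 1 1) ^ 2 + (δ 1 0 * (γ • z).im) ^ 2 :=
      (div_pos_iff_of_pos_left hpos).1 hpos'
    rw [div_le_iff₀ hq] at h
    nlinarith
  have h77 := sqrt_seven_mul_self
  refine ⟨hre, ?_, ?_, ?_⟩
  · have := key _ W_mem_frickeGroup
    simp [coe_W] at this
    nlinarith
  · have h7 := sqrt_seven_ne_zero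
    have := key ⟨!![√7 * 1, 3 / √7; √7 * 2, √7 * 1], by
      rw [Matrix.det_fin_two_of]; field_simp; linarith⟩
      (mem_frickeGroup_seven_iff.2 (Or.inr ⟨1, 3, 2, 1, by norm_num, by simp⟩))
    simp at this
    nlinarith
  · have h7 := sqrt_seven_ne_zero
    have := key ⟨!![√7 * 1, -4 / √7; √7 * 2, √7 * (-1)], by
      rw [Matrix.det_fin_two_of]; field_simp; linarith⟩
      (mem_frickeGroup_seven_iff.2 (Or.inr ⟨1, -4, 2, -1, by norm_num, by simp⟩))
    simp at this
    nlinarith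

/-- The corners (±5 + i√3)/14 have height about 0.124, so 1/10 is a safe bound. Below it the circle
about 0 forces |x| > 0.36, which is inside a circle about ±1/2. -/
theorem IsReduced.one_div_ten_le_im {z : ℍ} (h : IsReduced z) : 1 / 10 ≤ z.im := by
  by_contra! hlt
  have h0 := z.im_pos
  have h1 : z.im ^ 2 < 1 / 100 := by nlinarith
  have h2 := h.one_le
  have h3 := h.one_le_add
  have h4 := h.one_le_sub
  have h5 := abs_le.1 h.re_le
  have h6 : 36 / 100 < |z.re| := by
    by_contra! hcon
    have : z.re ^ 2 ≤ (36 / 100) ^ 2 := by rw [← sq_abs]; gcongr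
    nlinarith
  rcases le_total 0 z.re with hx | hx
  · rw [abs_of_nonneg hx] at h6
    nlinarith
  · rw [abs_of_nonpos hx] at h6
    nlinarith

theorem im_pointI_sq : pointI.im ^ 2 = 1 / 7 := by
  change (1 / √7) ^ 2 = (1 / 7 : ℝ)
  rw [div_pow, Real.sq_sqrt (by norm_num), one_pow]

theorem im_rho1_sq : rho1.im ^ 2 = 1 / 28 := by
  change (1 / (2 * √7)) ^ 2 = (1 / 28 : ℝ)
  rw [div_pow, mul_pow, Real.sq_sqrt (by norm_num)]
  norm_num

theorem im_rho2_sq : rho2.im ^ 2 = 3 / 196 := by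
  change (√3 / 14) ^ 2 = (3 / 196 : ℝ)
  rw [div_pow, Real.sq_sqrt (by norm_num)]
  norm_num

theorem re_pointI : pointI.re = 0 := rfl

theorem re_rho1 : rho1.re = -1 / 2 := rfl

theorem re_rho2 : rho2.re = -5 / 14 := rfl

theorem eq_of_re_eq_of_im_sq_eq {z w : ℍ} (h : z.re = w.re) (h' : z.im ^ 2 = w.im ^ 2) : z = w :=
  UpperHalfPlane.ext_re_im h ((pow_left_inj₀ z.im_pos.le w.im_pos.le two_ne_zero).1 h')

/-! ### Elliptic points and their stabilizers. -/

/-- Here B = d - a and C = -b for an element of Γ₀(7) of trace ±1 fixing a reduced point; the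
inequalities are the circles and the strip. For c ≥ 2 they would give |B|/c ≥ 5.2 and |B|/c ≤ 4.5.
-/
theorem eq_of_sq_add_three_eq {B c C : ℤ} (hc : 0 < c) (h : B ^ 2 + 3 = 28 * c * C) (hcC : c ≤ C)
    (hB : |B| ≤ 7 * c) (hBC : 2 * |B| ≤ 4 * C + 6 * c) : c = 1 ∧ C = 1 ∧ |B| = 5 := by
  rw [← sq_abs] at h
  set b := |B|
  have hb : 0 ≤ b := abs_nonneg B
  have h1 : 28 * c ^ 2 ≤ b ^ 2 + 3 := by nlinarith
  have h2 : 7 * c ^ 2 ≤ (7 * c - b) ^ 2 + 3 := by nlinarith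
  have hc1 : c = 1 := by
    by_contra hne
    have hc2 : 2 ≤ c := by omega
    have h3 : 26 * c ≤ 5 * b := by
      refine le_of_sq_le_sq ?_ (by positivity)
      nlinarith
    have h4 : 5 * c ≤ 2 * (7 * c - b) := by
      refine le_of_sq_le_sq ?_ (by linarith)
      nlinarith
    linarith
  subst hc1
  have h5 : b ≤ 7 := by linarith
  interval_cases b <;> omega

/-- The analogue for trace 0 in the Fricke coset. For c ≥ 4 the inequalities would give |a|/c ≥
0.365 and |a|/c ≤ 0.34. -/
theorem eq_of_seven_mul_sq_add_one_eq {a c C : ℤ} (hc : 0 < c) (h : 7 * a ^ 2 + 1 = c * C)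
    (hcC : c ≤ C) (ha : 2 * |a| ≤ c) (haC : 28 * |a| ≤ 4 * C + 6 * c) :
    (c = 1 ∧ C = 1 ∧ a = 0) ∨ (c = 2 ∧ C = 4 ∧ |a| = 1) := by
  rw [← sq_abs] at h
  rw [← abs_eq_zero (a := a)]
  set b := |a|
  have hb : 0 ≤ b := abs_nonneg a
  have h1 : c ^ 2 ≤ 7 * b ^ 2 + 1 := by nlinarith
  have h2 : c ^ 2 - 4 ≤ 7 * (c - 2 * b) ^ 2 := by nlinarith
  have hc3 : c ≤ 3 := by
    by_contra hne
    have hc4 : 4 ≤ c := by omega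
    have h3 : 365 * c ≤ 1000 * b := by
      refine le_of_sq_le_sq ?_ (by positivity)
      nlinarith
    have h4 : 32 * c ≤ 100 * (c - 2 * b) := by
      refine le_of_sq_le_sq ?_ (by linarith)
      nlinarith
    linarith
  have h5 : b ≤ 1 := by omega
  interval_cases c <;> interval_cases b <;> omega

/-- The reduced points with a nontrivial stabilizer. -/
theorem IsReduced.re_norm_of_smul_eq {z : ℍ} (hz : IsReduced z) {γ : SL(2, ℝ)}
    (hγ : γ ∈ frickeGroup 7) (hfix : γ • z = z) (h0 : γ 1 0 ≠ 0) :
    (z.re = 0 ∧ z.im ^ 2 = 1 / 7) ∨ (|z.re| = 1 / 2 ∧ z.im ^ 2 = 1 / 28) ∨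
      (|z.re| = 5 / 14 ∧ z.im ^ 2 = 3 / 196) := by
  wlog hpos : 0 < γ 1 0 generalizing γ
  · refine this (γ := -γ) ?_ (by rw [neg_smul_eq, hfix]) (by simpa using h0) ?_
    · rw [← neg_one_mul]; exact mul_mem neg_one_mem_frickeGroup hγ
    · have := lt_of_le_of_ne (not_lt.1 hpos) h0
      simpa using this
  obtain ⟨f1, f2⟩ := (smul_eq_self_iff γ z).1 hfix
  obtain ⟨hre, hn, hp, hm⟩ := hz
  have hy := z.im_pos
  set x := z.re
  set y := z.im
  -- `N` is |z|². The two circles about ±1/2 combine into one inequality in `N` and |x|.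
  obtain ⟨N, hN⟩ : ∃ N, N = x ^ 2 + y ^ 2 := ⟨_, rfl⟩
  have hNx : x ^ 2 < N := by rw [hN]; nlinarith
  rw [← hN] at f2 hn
  have hN' : 1 ≤ 28 * (N - |x|) + 7 := by
    rcases abs_cases x with ⟨hx, -⟩ | ⟨hx, -⟩ <;> rw [hx] <;> nlinarith
  rcases mem_frickeGroup_seven_iff.1 hγ with ⟨a, b, c, d, h, h1, h2, h3, h4⟩ |
    ⟨a, b, c, d, h, h1, h2, h3, h4⟩
  · rw [h1, h3, h4] at f1
    rw [h2, h3] at f2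
    rw [h3] at hpos
    have hcR : (0 : ℝ) < c := by linarith
    have hc : 0 < c := by exact_mod_cast hcR
    have hR : (a : ℝ) * d - 7 * b * c = 1 := by exact_mod_cast h
    -- An element fixing a point of ℍ is elliptic: (a + d)² = 4 - (14 c y)².
    have ht : (a + d) ^ 2 < 4 := by
      have : ((a : ℝ) + d) ^ 2 < 4 := by
        have e : ((a : ℝ) + d) ^ 2 = 4 + 196 * c ^ 2 * (x ^ 2 - N) := by
          linear_combination (d - a - 14 * x * c : ℝ) * f1 + 4 * hR + 28 * c * f2
        have := mul_pos (by positivity : (0 : ℝ) < 196 * c ^ 2) (sub_pos.2 hNx)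
        linarith
      exact_mod_cast this
    have ht1 : a + d < 2 := by nlinarith
    have ht2 : -2 < a + d := by nlinarith
    -- Trace 0 would give -a² ≡ 1 mod 7, but -1 is not a square mod 7.
    have ht3 : a + d ≠ 0 := by
      intro hs
      obtain rfl : d = -a := by linarith
      have h7 : ((-(a * a) - 7 * b * c : ℤ) : ZMod 7) = ((1 : ℤ) : ZMod 7) := by
        rw [← h]; ring_nf
      push_cast at h7
      rw [show (7 : ZMod 7) = 0 from rfl, zero_mul, zero_mul, sub_zero] at h7
      generalize (a : ZMod 7) = u at h7
      revert u
      decide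
    have hs : (a + d) ^ 2 = 1 := by
      have : a + d = 1 ∨ a + d = -1 := by omega
      rcases this with h | h <;> rw [h] <;> norm_num
    have hB : (d - a) ^ 2 + 3 = 28 * c * (-b) := by linear_combination hs - 4 * h
    have hC : (-b : ℝ) = 7 * c * N := by linear_combination -f2
    have habs : |(d : ℝ) - a| = 14 * c * |x| := by
      rw [f1, abs_mul, abs_mul, abs_neg, abs_of_pos (show (0 : ℝ) < 7 * c by linarith)]
      norm_num
      ring
    obtain ⟨rfl, hb, hda⟩ := eq_of_sq_add_three_eq hc hB
      (by
        have : (c : ℝ) ≤ -b := by rw [hC]; nlinarith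
        exact_mod_cast this)
      (by
        have : |(d : ℝ) - a| ≤ 7 * c := by rw [habs]; nlinarith
        exact_mod_cast this)
      (by
        have : 2 * |(d : ℝ) - a| ≤ 4 * -b + 6 * c := by
          rw [habs, hC]
          have := mul_le_mul_of_nonneg_left hN' hcR.le
          linarith
        exact_mod_cast this)
    have hbR : (-b : ℝ) = 1 := by exact_mod_cast hb
    have hdaR : |(d : ℝ) - a| = 5 := by exact_mod_cast hda
    rw [hbR] at hC
    rw [hdaR] at habs
    push_cast at hC habs
    have hx : |x| = 5 / 14 := by linarith
    have hx2 : x ^ 2 = (5 / 14) ^ 2 := by rw [← hx, sq_abs]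
    exact Or.inr (Or.inr ⟨hx, by linarith⟩)
  · have hs7 : (0 : ℝ) < √7 := by positivity
    have h77 := sqrt_seven_mul_self
    rw [h1, h3, h4] at f1
    rw [h2, h3, div_eq_iff hs7.ne'] at f2
    rw [h3] at hpos
    have hcR : (0 : ℝ) < c := pos_of_mul_pos_right hpos hs7.le
    have hc : 0 < c := by exact_mod_cast hcR
    have hR : (7 : ℝ) * a * d - b * c = 1 := by exact_mod_cast h
    have f1' : (d : ℝ) - a = -2 * x * c := by
      apply mul_left_cancel₀ hs7.ne'
      linear_combination f1
    have f2' : (b : ℝ) = -7 * c * N := by linear_combination f2 - c * N * h77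
    -- Now the trace is √7 (a + d), so being elliptic forces it to vanish.
    have ht : 7 * (a + d) ^ 2 < 4 := by
      have : 7 * ((a : ℝ) + d) ^ 2 < 4 := by
        have e : 7 * ((a : ℝ) + d) ^ 2 = 4 + 28 * c ^ 2 * (x ^ 2 - N) := by
          linear_combination 7 * (d - a - 2 * x * c : ℝ) * f1' + 4 * hR + 4 * c * f2'
        have := mul_pos (by positivity : (0 : ℝ) < 28 * c ^ 2) (sub_pos.2 hNx)
        linarith
      exact_mod_cast this
    have hs : a + d = 0 := by
      have : (a + d) ^ 2 = 0 := by have := sq_nonneg (a + d); omega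
      simpa using this
    obtain rfl : d = -a := by linarith
    have hx : (a : ℝ) = x * c := by push_cast at f1'; linarith
    have hC : (-b : ℝ) = 7 * c * N := by linear_combination -f2'
    have habs : |(a : ℝ)| = |x| * c := by rw [hx, abs_mul, abs_of_pos hcR]
    have := eq_of_seven_mul_sq_add_one_eq (a := a) hc (C := -b) (by linear_combination -h)
      (by
        have : (c : ℝ) ≤ -b := by rw [hC]; nlinarith
        exact_mod_cast this)
      (by
        have : 2 * |(a : ℝ)| ≤ c := by rw [habs]; nlinarith
        exact_mod_cast this)
      (by
        have : 28 * |(a : ℝ)| ≤ 4 * -b + 6 * c := by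
          rw [habs, hC]
          have := mul_le_mul_of_nonneg_left hN' hcR.le
          linarith
        exact_mod_cast this)
    rcases this with ⟨rfl, hb, rfl⟩ | ⟨rfl, hb, ha⟩
    · have hbR : (-b : ℝ) = 1 := by exact_mod_cast hb
      rw [hbR] at hC
      push_cast at hC hx
      have hx0 : x = 0 := by linarith
      rw [hx0] at hN
      exact Or.inl ⟨hx0, by linarith⟩
    · have hbR : (-b : ℝ) = 4 := by exact_mod_cast hb
      have haR : |(a : ℝ)| = 1 := by exact_mod_cast ha
      rw [hbR] at hC
      rw [haR] at habs
      push_cast at hC habs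
      have hx0 : |x| = 1 / 2 := by linarith
      have hx2 : x ^ 2 = (1 / 2) ^ 2 := by rw [← hx0, sq_abs]
      exact Or.inr (Or.inl ⟨hx0, by linarith⟩)

/-- The order of the stabilizer of a point in `Γ₀*(7)`; it is twice the order of its image in the
group of automorphisms of `ℍ`. -/
noncomputable def isotropyOrder (z : ℍ) : ℕ := Nat.card (MulAction.stabilizer (frickeGroup 7) z)

theorem orbit_eq_orbit_iff {z w : ℍ} : orbit 7 z = orbit 7 w ↔ ∃ γ ∈ frickeGroup 7, γ • w = z := by
  rw [orbit, orbit, Quotient.eq]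
  constructor
  · rintro ⟨γ, h⟩
    exact ⟨γ, γ.2, h⟩
  · rintro ⟨γ, hγ, h⟩
    exact ⟨⟨γ, hγ⟩, h⟩

theorem orbit_out (P : Orbits 7) : orbit 7 P.out = P := Quotient.out_eq P

theorem orbit_smul {γ : SL(2, ℝ)} (hγ : γ ∈ frickeGroup 7) (z : ℍ) :
    orbit 7 (γ • z) = orbit 7 z :=
  orbit_eq_orbit_iff.2 ⟨γ, hγ, rfl⟩

theorem isotropyOrder_smul {γ : SL(2, ℝ)} (hγ : γ ∈ frickeGroup 7) (z : ℍ) :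
    isotropyOrder (γ • z) = isotropyOrder z :=
  (Nat.card_congr (MulAction.stabilizerEquivStabilizer
    (g := (⟨γ, hγ⟩ : frickeGroup 7)) (a := z) (b := γ • z) rfl).toEquiv).symm

theorem isotropyOrder_congr {z w : ℍ} (h : orbit 7 z = orbit 7 w) :
    isotropyOrder z = isotropyOrder w := by
  obtain ⟨γ, hγ, rfl⟩ := orbit_eq_orbit_iff.1 h
  exact isotropyOrder_smul hγ w

/-- An element fixing z is determined by its first column, so stabilizers can be counted as explicit
sets of pairs. -/
theorem isotropyOrder_eq_ncard (z : ℍ) : isotropyOrder z =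
    ((fun γ : SL(2, ℝ) ↦ (γ 0 0, γ 1 0)) '' {γ | γ ∈ frickeGroup 7 ∧ γ • z = z}).ncard := by
  rw [Set.InjOn.ncard_image]
  · have : {γ : SL(2, ℝ) | γ ∈ frickeGroup 7 ∧ γ • z = z} =
        Subtype.val '' (MulAction.stabilizer (frickeGroup 7) z : Set (frickeGroup 7)) := by
      ext γ
      constructor
      · rintro ⟨h, h'⟩
        exact ⟨⟨γ, h⟩, h', rfl⟩
      · rintro ⟨γ, h, rfl⟩
        exact ⟨γ.2, h⟩
    rw [this, Set.ncard_image_of_injective _ Subtype.val_injective]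
    rfl
  · rintro γ ⟨-, hγ⟩ δ ⟨-, hδ⟩ h
    simp only [Prod.mk.injEq] at h
    obtain ⟨a1, a2⟩ := (smul_eq_self_iff _ _).1 hγ
    obtain ⟨b1, b2⟩ := (smul_eq_self_iff _ _).1 hδ
    ext i j
    fin_cases i <;> fin_cases j
    · exact h.1
    · exact a2.trans (h.2 ▸ b2.symm)
    · exact h.2
    · change γ 1 1 = δ 1 1
      linear_combination a1 - b1 + h.1 - 2 * z.re * h.2

theorem exists_mem_of_int (a b c d : ℤ) (h : a * d - 7 * b * c = 1) :
    ∃ γ ∈ frickeGroup 7, γ 0 0 = a ∧ γ 0 1 = b ∧ γ 1 0 = 7 * c ∧ γ 1 1 = d := by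
  have hR : (a : ℝ) * d - 7 * b * c = 1 := by exact_mod_cast h
  obtain ⟨γ, hγ⟩ : ∃ γ : SL(2, ℝ), (γ : Matrix (Fin 2) (Fin 2) ℝ) = !![(a : ℝ), b; 7 * c, d] :=
    ⟨⟨_, by rw [Matrix.det_fin_two_of]; linear_combination hR⟩, rfl⟩
  have he : γ 0 0 = a ∧ γ 0 1 = b ∧ γ 1 0 = 7 * c ∧ γ 1 1 = d := by simp [hγ]
  exact ⟨γ, mem_frickeGroup_seven_iff.2 (Or.inl ⟨a, b, c, d, h, he⟩), he⟩

theorem exists_mem_of_int_sqrt (a b c d : ℤ) (h : 7 * a * d - b * c = 1) :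
    ∃ γ ∈ frickeGroup 7, γ 0 0 = √7 * a ∧ γ 0 1 = b / √7 ∧ γ 1 0 = √7 * c ∧ γ 1 1 = √7 * d := by
  have hR : (7 : ℝ) * a * d - b * c = 1 := by exact_mod_cast h
  have h7 := sqrt_seven_ne_zero
  have h77 := sqrt_seven_mul_self
  obtain ⟨γ, hγ⟩ : ∃ γ : SL(2, ℝ),
      (γ : Matrix (Fin 2) (Fin 2) ℝ) = !![√7 * a, b / √7; √7 * c, √7 * d] := by
    refine ⟨⟨_, ?_⟩, rfl⟩
    rw [Matrix.det_fin_two_of]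
    field_simp
    linear_combination hR + a * d * h77
  have he : γ 0 0 = √7 * a ∧ γ 0 1 = b / √7 ∧ γ 1 0 = √7 * c ∧ γ 1 1 = √7 * d := by simp [hγ]
  exact ⟨γ, mem_frickeGroup_seven_iff.2 (Or.inr ⟨a, b, c, d, h, he⟩), he⟩

theorem isotropyOrder_eq_two {z : ℍ} (h : ∀ γ ∈ frickeGroup 7, γ • z = z → γ 1 0 = 0) :
    isotropyOrder z = 2 := by
  have hset : ((fun γ : SL(2, ℝ) ↦ (γ 0 0, γ 1 0)) '' {γ | γ ∈ frickeGroup 7 ∧ γ • z = z}) =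
      {((1 : ℝ), (0 : ℝ)), (-1, 0)} := by
    ext p
    constructor
    · rintro ⟨γ, ⟨hγ, hz⟩, rfl⟩
      obtain ⟨n, rfl | rfl⟩ := eq_translation_of_apply_eq_zero hγ (h γ hγ hz) <;>
        simp [coe_translation]
    · rintro (rfl | rfl)
      · exact ⟨1, ⟨one_mem _, one_smul _ z⟩, by simp⟩
      · exact ⟨-1, ⟨neg_one_mem_frickeGroup, by rw [neg_smul_eq, one_smul]⟩, by simp⟩
  rw [isotropyOrder_eq_ncard, hset, Set.ncard_pair (by norm_num)]

/-- Fixing i/√7 means d = a and, for the integer parameters, b = -c. The determinant becomes d² +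
7c² = 1 on Γ₀(7) and 7d² + c² = 1 on the other coset, leaving ±1 and ±W. -/
theorem isotropyOrder_pointI : isotropyOrder pointI = 4 := by
  have h7 : (0 : ℝ) < √7 := by positivity
  have h77 := sqrt_seven_mul_self
  have hset : ((fun γ : SL(2, ℝ) ↦ (γ 0 0, γ 1 0)) ''
      {γ | γ ∈ frickeGroup 7 ∧ γ • pointI = pointI}) =
      {((1 : ℝ), (0 : ℝ)), (-1, 0), (0, √7), (0, -√7)} := by
    ext p
    constructor
    · rintro ⟨γ, ⟨hγ, hz⟩, rfl⟩
      obtain ⟨f1, f2⟩ := (smul_eq_self_iff _ _).1 hz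
      rw [im_pointI_sq, re_pointI] at f2
      rw [re_pointI] at f1
      rcases mem_frickeGroup_seven_iff.1 hγ with ⟨a, b, c, d, h, h1, h2, h3, h4⟩ |
        ⟨a, b, c, d, h, h1, h2, h3, h4⟩
      · rw [h1, h3, h4] at f1
        rw [h2, h3] at f2
        obtain rfl : d = a := by
          have : (d : ℝ) = a := by linarith
          exact_mod_cast this
        obtain rfl : b = -c := by
          have : (b : ℝ) = -c := by linarith
          exact_mod_cast this
        obtain rfl : c = 0 := by
          have : c ^ 2 < 1 := by nlinarith [sq_nonneg d]
          have := sq_nonneg c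
          exact pow_eq_zero_iff two_ne_zero |>.1 (by omega)
        have : d = 1 ∨ d = -1 := by
          have : d ^ 2 = 1 := by linarith
          exact mul_self_eq_one_iff.1 (by rw [← sq, this])
        rcases this with rfl | rfl <;> simp [h1, h3]
      · rw [h1, h3, h4] at f1
        rw [h2, h3, div_eq_iff h7.ne'] at f2
        obtain rfl : d = a := by
          have : (d : ℝ) = a := by
            apply mul_left_cancel₀ h7.ne'
            linarith
          exact_mod_cast this
        obtain rfl : b = -c := by
          have : (b : ℝ) = -c := by linear_combination f2 - c / 7 * h77
          exact_mod_cast this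
        obtain rfl : d = 0 := by
          have : d ^ 2 < 1 := by nlinarith [sq_nonneg c]
          have := sq_nonneg d
          exact pow_eq_zero_iff two_ne_zero |>.1 (by omega)
        have : c = 1 ∨ c = -1 := by
          have : c ^ 2 = 1 := by linarith
          exact mul_self_eq_one_iff.1 (by rw [← sq, this])
        rcases this with rfl | rfl <;> simp [h1, h3]
    · rintro (rfl | rfl | rfl | rfl)
      · exact ⟨1, ⟨one_mem _, one_smul _ _⟩, by simp⟩
      · exact ⟨-1, ⟨neg_one_mem_frickeGroup, by rw [neg_smul_eq, one_smul]⟩, by simp⟩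
      · obtain ⟨γ, hγ, h1, h2, h3, h4⟩ := exists_mem_of_int_sqrt 0 (-1) 1 0 (by norm_num)
        refine ⟨γ, ⟨hγ, (smul_eq_self_iff _ _).2 ?_⟩, by simp [h1, h3]⟩
        rw [im_pointI_sq, re_pointI, h1, h2, h3, h4]
        push_cast
        refine ⟨by ring, ?_⟩
        rw [div_eq_iff h7.ne']
        linear_combination 1 / 7 * h77
      · obtain ⟨γ, hγ, h1, h2, h3, h4⟩ := exists_mem_of_int_sqrt 0 1 (-1) 0 (by norm_num)
        refine ⟨γ, ⟨hγ, (smul_eq_self_iff _ _).2 ?_⟩, by simp [h1, h3]⟩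
        rw [im_pointI_sq, re_pointI, h1, h2, h3, h4]
        push_cast
        refine ⟨by ring, ?_⟩
        rw [div_eq_iff h7.ne']
        linear_combination -1 / 7 * h77
  have h7' : √7 ≠ -√7 := by linarith
  rw [isotropyOrder_eq_ncard, hset]
  repeat rw [Set.ncard_insert_of_notMem]
  all_goals norm_num [h7.ne', h7.ne, h7', eq_comm]

/-- Four times the determinant equation reads (2a + 7c)² + 7c² = 4 on Γ₀(7) and 7(2a + c)² + c² = 4
on the other coset; each has two admissible solutions. -/
theorem isotropyOrder_rho1 : isotropyOrder rho1 = 4 := by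
  have h7 : (0 : ℝ) < √7 := by positivity
  have h77 := sqrt_seven_mul_self
  have hset : ((fun γ : SL(2, ℝ) ↦ (γ 0 0, γ 1 0)) ''
      {γ | γ ∈ frickeGroup 7 ∧ γ • rho1 = rho1}) =
      {((1 : ℝ), (0 : ℝ)), (-1, 0), (-√7, √7 * 2), (√7, √7 * (-2))} := by
    ext p
    constructor
    · rintro ⟨γ, ⟨hγ, hz⟩, rfl⟩
      obtain ⟨f1, f2⟩ := (smul_eq_self_iff _ _).1 hz
      rw [im_rho1_sq, re_rho1] at f2
      rw [re_rho1] at f1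
      rcases mem_frickeGroup_seven_iff.1 hγ with ⟨a, b, c, d, h, h1, h2, h3, h4⟩ |
        ⟨a, b, c, d, h, h1, h2, h3, h4⟩
      · rw [h1, h3, h4] at f1
        rw [h2, h3] at f2
        obtain rfl : d = a + 7 * c := by
          have : (d : ℝ) = a + 7 * c := by linarith
          exact_mod_cast this
        obtain rfl : b = -2 * c := by
          have : (b : ℝ) = -2 * c := by linarith
          exact_mod_cast this
        obtain rfl : c = 0 := by
          have : c ^ 2 < 1 := by nlinarith [sq_nonneg (2 * a + 7 * c)]
          have := sq_nonneg c
          exact pow_eq_zero_iff two_ne_zero |>.1 (by omega)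
        have : a = 1 ∨ a = -1 := by
          have : a ^ 2 = 1 := by linarith
          exact mul_self_eq_one_iff.1 (by rw [← sq, this])
        rcases this with rfl | rfl <;> simp [h1, h3]
      · rw [h1, h3, h4] at f1
        rw [h2, h3, div_eq_iff h7.ne'] at f2
        obtain rfl : d = a + c := by
          have : (d : ℝ) = a + c := by
            apply mul_left_cancel₀ h7.ne'
            linarith
          exact_mod_cast this
        obtain rfl : b = -2 * c := by
          have : (b : ℝ) = -2 * c := by linear_combination f2 - 2 * c / 7 * h77
          exact_mod_cast this
        have hac : 2 * a + c = 0 := by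
          have : (2 * a + c) ^ 2 < 1 := by nlinarith [sq_nonneg c]
          have := sq_nonneg (2 * a + c)
          exact pow_eq_zero_iff two_ne_zero |>.1 (by omega)
        obtain rfl : c = -2 * a := by linarith
        have : a = 1 ∨ a = -1 := by
          have : a ^ 2 = 1 := by linarith
          exact mul_self_eq_one_iff.1 (by rw [← sq, this])
        rcases this with rfl | rfl <;> simp [h1, h3]
    · rintro (rfl | rfl | rfl | rfl)
      · exact ⟨1, ⟨one_mem _, one_smul _ _⟩, by simp⟩
      · exact ⟨-1, ⟨neg_one_mem_frickeGroup, by rw [neg_smul_eq, one_smul]⟩, by simp⟩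
      · obtain ⟨γ, hγ, h1, h2, h3, h4⟩ := exists_mem_of_int_sqrt (-1) (-4) 2 1 (by norm_num)
        refine ⟨γ, ⟨hγ, (smul_eq_self_iff _ _).2 ?_⟩, by simp [h1, h3]⟩
        rw [im_rho1_sq, re_rho1, h1, h2, h3, h4]
        push_cast
        refine ⟨by ring, ?_⟩
        rw [div_eq_iff h7.ne']
        linear_combination 4 / 7 * h77
      · obtain ⟨γ, hγ, h1, h2, h3, h4⟩ := exists_mem_of_int_sqrt 1 4 (-2) (-1) (by norm_num)
        refine ⟨γ, ⟨hγ, (smul_eq_self_iff _ _).2 ?_⟩, by simp [h1, h3]⟩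
        rw [im_rho1_sq, re_rho1, h1, h2, h3, h4]
        push_cast
        refine ⟨by ring, ?_⟩
        rw [div_eq_iff h7.ne']
        linear_combination -4 / 7 * h77
  have h7' : √7 ≠ -√7 := by linarith
  rw [isotropyOrder_eq_ncard, hset]
  repeat rw [Set.ncard_insert_of_notMem]
  all_goals norm_num [h7.ne', h7.ne, h7', h7'.symm]

/-- On Γ₀(7) four times the determinant equation reads (2a + 5c)² + 3c² = 4, with six solutions. On
the other coset 7(d - a) = 5c makes 7 divide c, hence also the determinant. -/
theorem isotropyOrder_rho2 : isotropyOrder rho2 = 6 := by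
  have h7 : (0 : ℝ) < √7 := by positivity
  have h77 := sqrt_seven_mul_self
  have hset : ((fun γ : SL(2, ℝ) ↦ (γ 0 0, γ 1 0)) ''
      {γ | γ ∈ frickeGroup 7 ∧ γ • rho2 = rho2}) =
      {((1 : ℝ), (0 : ℝ)), (-1, 0), (-2, 7), (-3, 7), (2, -7), (3, -7)} := by
    ext p
    constructor
    · rintro ⟨γ, ⟨hγ, hz⟩, rfl⟩
      obtain ⟨f1, f2⟩ := (smul_eq_self_iff _ _).1 hz
      rw [im_rho2_sq, re_rho2] at f2
      rw [re_rho2] at f1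
      rcases mem_frickeGroup_seven_iff.1 hγ with ⟨a, b, c, d, h, h1, h2, h3, h4⟩ |
        ⟨a, b, c, d, h, h1, h2, h3, h4⟩
      · rw [h1, h3, h4] at f1
        rw [h2, h3] at f2
        obtain rfl : d = a + 5 * c := by
          have : (d : ℝ) = a + 5 * c := by linarith
          exact_mod_cast this
        obtain rfl : b = -c := by
          have : (b : ℝ) = -c := by linarith
          exact_mod_cast this
        have hc1 : c < 2 := by nlinarith [sq_nonneg (2 * a + 5 * c)]
        have hc2 : -2 < c := by nlinarith [sq_nonneg (2 * a + 5 * c)]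
        have ha1 : a < 4 := by nlinarith [sq_nonneg (2 * c + a)]
        have ha2 : -4 < a := by nlinarith [sq_nonneg (2 * c + a)]
        interval_cases c <;> interval_cases a <;> first | (exfalso; omega) | simp [h1, h3]
      · exfalso
        rw [h1, h3, h4] at f1
        rw [h2, h3, div_eq_iff h7.ne'] at f2
        have hbc : b = -c := by
          have : (b : ℝ) = -c := by linear_combination f2 - c / 7 * h77
          exact_mod_cast this
        have hd : 7 * (d - a) = 5 * c := by
          have : 7 * ((d : ℝ) - a) = 5 * c := by
            apply mul_left_cancel₀ h7.ne'
            linarith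
          exact_mod_cast this
        obtain ⟨e, rfl⟩ : (7 : ℤ) ∣ c := by omega
        subst hbc
        have : 7 * (a * d + 7 * e * e) = 1 := by linarith
        omega
    · rintro (rfl | rfl | rfl | rfl | rfl | rfl)
      · exact ⟨1, ⟨one_mem _, one_smul _ _⟩, by simp⟩
      · exact ⟨-1, ⟨neg_one_mem_frickeGroup, by rw [neg_smul_eq, one_smul]⟩, by simp⟩
      · obtain ⟨γ, hγ, h1, h2, h3, h4⟩ := exists_mem_of_int (-2) (-1) 1 3 (by norm_num)
        refine ⟨γ, ⟨hγ, (smul_eq_self_iff _ _).2 ?_⟩, by simp [h1, h3]⟩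
        rw [im_rho2_sq, re_rho2, h1, h2, h3, h4]
        norm_num
      · obtain ⟨γ, hγ, h1, h2, h3, h4⟩ := exists_mem_of_int (-3) (-1) 1 2 (by norm_num)
        refine ⟨γ, ⟨hγ, (smul_eq_self_iff _ _).2 ?_⟩, by simp [h1, h3]⟩
        rw [im_rho2_sq, re_rho2, h1, h2, h3, h4]
        norm_num
      · obtain ⟨γ, hγ, h1, h2, h3, h4⟩ := exists_mem_of_int 2 1 (-1) (-3) (by norm_num)
        refine ⟨γ, ⟨hγ, (smul_eq_self_iff _ _).2 ?_⟩, by simp [h1, h3]⟩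
        rw [im_rho2_sq, re_rho2, h1, h2, h3, h4]
        norm_num
      · obtain ⟨γ, hγ, h1, h2, h3, h4⟩ := exists_mem_of_int 3 1 (-1) (-2) (by norm_num)
        refine ⟨γ, ⟨hγ, (smul_eq_self_iff _ _).2 ?_⟩, by simp [h1, h3]⟩
        rw [im_rho2_sq, re_rho2, h1, h2, h3, h4]
        norm_num
  rw [isotropyOrder_eq_ncard, hset]
  repeat rw [Set.ncard_insert_of_notMem]
  all_goals norm_num

/-- The stabilizers have equal order and do not separate these orbits. The imaginary parts have
ratio 2, and neither d² + 7c² = 2 nor 7d² + c² = 2 is soluble. -/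
theorem orbit_pointI_ne_orbit_rho1 : orbit 7 pointI ≠ orbit 7 rho1 := by
  intro h
  obtain ⟨γ, hγ, hz⟩ := orbit_eq_orbit_iff.1 h.symm
  have him := im_smul_eq γ pointI
  rw [hz, re_pointI, mul_zero, zero_add] at him
  have hI := pointI.im_pos
  have hq : 0 < γ 1 1 ^ 2 + (γ 1 0 * pointI.im) ^ 2 :=
    (div_pos_iff_of_pos_left hI).1 (him ▸ rho1.im_pos)
  have h2 : (γ 1 1 ^ 2 + (γ 1 0 * pointI.im) ^ 2) ^ 2 = 2 ^ 2 := by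
    rw [eq_div_iff hq.ne'] at him
    have := congrArg (· ^ 2) him
    simp only [mul_pow _ (_ + _), im_rho1_sq, im_pointI_sq] at this
    linarith
  have h3 : γ 1 1 ^ 2 + (γ 1 0 * pointI.im) ^ 2 = 2 :=
    (pow_left_inj₀ hq.le (by norm_num) two_ne_zero).1 h2
  rw [mul_pow, im_pointI_sq] at h3
  rcases mem_frickeGroup_seven_iff.1 hγ with ⟨a, b, c, d, -, -, -, h5, h4⟩ |
    ⟨a, b, c, d, -, -, -, h5, h4⟩
  · rw [h4, h5] at h3
    have h6 : d ^ 2 + 7 * c ^ 2 = 2 := by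
      have : (d : ℝ) ^ 2 + 7 * c ^ 2 = 2 := by linarith
      exact_mod_cast this
    have hc : c ^ 2 = 0 := by have := sq_nonneg c; have := sq_nonneg d; omega
    rw [hc] at h6
    have : d < 2 := by nlinarith
    have : -2 < d := by nlinarith
    interval_cases d <;> omega
  · rw [h4, h5, mul_pow, mul_pow, Real.sq_sqrt (by norm_num)] at h3
    have h6 : 7 * d ^ 2 + c ^ 2 = 2 := by
      have : 7 * (d : ℝ) ^ 2 + c ^ 2 = 2 := by linarith
      exact_mod_cast this
    have hd : d ^ 2 = 0 := by have := sq_nonneg c; have := sq_nonneg d; omega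
    rw [hd] at h6
    have : c < 2 := by nlinarith
    have : -2 < c := by nlinarith
    interval_cases c <;> omega

theorem orbit_pointI_ne_orbit_rho2 : orbit 7 pointI ≠ orbit 7 rho2 := fun h ↦ by
  simpa [isotropyOrder_pointI, isotropyOrder_rho2] using isotropyOrder_congr h

theorem orbit_rho1_ne_orbit_rho2 : orbit 7 rho1 ≠ orbit 7 rho2 := fun h ↦ by
  simpa [isotropyOrder_rho1, isotropyOrder_rho2] using isotropyOrder_congr h

/-- On |z|² = 1/7 one has -1/(7z) = -z̄. This identifies the corner (5 + i√3)/14 with ρ_{7,2}. -/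
theorem W_smul_re_im {z : ℍ} (h : 7 * (z.re ^ 2 + z.im ^ 2) = 1) :
    (W 7 • z).re = -z.re ∧ (W 7 • z).im = z.im := by
  have h77 := sqrt_seven_mul_self
  have h7 := sqrt_seven_ne_zero
  have : ((W 7 • z : ℍ) : ℂ) = -z.re + z.im * Complex.I := by
    rw [coe_smul_eq, div_eq_iff (denom_ne_zero _ z)]
    have h77C : (√7 : ℂ) * √7 = 7 := by exact_mod_cast h77
    have h7C : (√7 : ℂ) ≠ 0 := by exact_mod_cast h7
    have hC : 7 * ((z.re : ℂ) ^ 2 + z.im ^ 2) = 1 := by exact_mod_cast h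
    rw [← z.re_add_im]
    simp [coe_W]
    field_simp
    linear_combination hC - (z.im : ℂ) ^ 2 * (√7 * √7) * Complex.I_sq +
      ((z.re : ℂ) ^ 2 + z.im ^ 2) * h77C
  exact ⟨by rw [← coe_re, this]; simp, by rw [← coe_im, this]; simp⟩

/-- The points outside the three exceptional orbits have the stabilizer `{1, -1}`. -/
theorem isotropyOrder_eq_two_of_orbit_ne {z : ℍ} (h1 : orbit 7 z ≠ orbit 7 pointI)
    (h2 : orbit 7 z ≠ orbit 7 rho1) (h3 : orbit 7 z ≠ orbit 7 rho2) : isotropyOrder z = 2 := by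
  obtain ⟨δ, hδ, hred⟩ := exists_smul_isReduced z
  rw [← isotropyOrder_smul hδ z]
  rw [← orbit_smul hδ z] at h1 h2 h3
  set w := δ • z
  refine isotropyOrder_eq_two fun γ hγ hfix ↦ ?_
  by_contra hne
  rcases hred.re_norm_of_smul_eq hγ hfix hne with ⟨hx, hy⟩ | ⟨hx, hy⟩ | ⟨hx, hy⟩
  · exact h1 (congrArg _ (eq_of_re_eq_of_im_sq_eq (hx.trans re_pointI.symm)
      (hy.trans im_pointI_sq.symm)))
  · rcases eq_or_eq_neg_of_abs_eq hx with hx | hx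
    · refine h2 ?_
      rw [← orbit_smul (translation_mem (-1)) w]
      refine congrArg _ (eq_of_re_eq_of_im_sq_eq ?_ ?_)
      · rw [← coe_re, coe_translation_smul, re_rho1]
        simp [hx]
        norm_num
      · rw [im_smul_of_apply_eq_zero (translation_mem _) (by simp [coe_translation]), hy, im_rho1_sq]
    · exact h2 (congrArg _ (eq_of_re_eq_of_im_sq_eq (by rw [hx, re_rho1]; norm_num)
        (hy.trans im_rho1_sq.symm)))
  · rcases eq_or_eq_neg_of_abs_eq hx with hx | hx
    · refine h3 ?_
      rw [← orbit_smul W_mem_frickeGroup w]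
      obtain ⟨e1, e2⟩ := W_smul_re_im (z := w) (by rw [hx, hy]; norm_num)
      exact congrArg _ (eq_of_re_eq_of_im_sq_eq (by rw [e1, hx, re_rho2]; norm_num)
        (by rw [e2, hy, im_rho2_sq]))
    · exact h3 (congrArg _ (eq_of_re_eq_of_im_sq_eq (by rw [hx, re_rho2]; norm_num)
        (hy.trans im_rho2_sq.symm)))

end Fricke

/-! ### Weighted sums over the orbits near a point. -/

section OrbitSum

variable {G X : Type*} [Group G] [MulAction G X]

/-- Orbit-stabilizer for G_p acting on z: by the hypothesis G_z lies in G_p. -/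
theorem card_stabilizer_eq_card_orbit_mul {p z : X}
    (h : ∀ g : G, g • z = z → g • p = p) :
    Nat.card (MulAction.stabilizer G p) =
      (MulAction.orbit (MulAction.stabilizer G p) z).ncard *
        Nat.card (MulAction.stabilizer G z) := by
  rw [Subgroup.card_eq_card_quotient_mul_card_subgroup
    (MulAction.stabilizer (MulAction.stabilizer G p) z)]
  congr 1
  · exact (Nat.card_congr (MulAction.orbitEquivQuotientStabilizer _ z)).symm
  · refine Nat.card_congr ⟨fun g ↦ ⟨g.1.1, g.2⟩, fun g ↦ ⟨⟨g.1, h _ g.2⟩, g.2⟩, fun _ ↦ rfl,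
      fun _ ↦ rfl⟩

/-- The weighted sum of an invariant function over the orbits meeting a small neighbourhood `U`
of `p`, as a sum over `U`. -/
theorem finsum_orbit_div_card_stabilizer {p : X} {U : Set X}
    (hfin : Finite (MulAction.stabilizer G p))
    (hU : ∀ g : G, ∀ z ∈ U, g • z ∈ U → g • p = p)
    (hU' : ∀ g : G, g • p = p → ∀ z ∈ U, g • z ∈ U)
    {h : X → ℤ} (hinv : ∀ (g : G) (z : X), h (g • z) = h z)
    (hsupp : (U ∩ Function.support h).Finite) :
    (((Quotient.mk (MulAction.orbitRel G X)) '' U) ∩ Function.support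
      (fun P ↦ 2 * (h P.out : ℚ) / Nat.card (MulAction.stabilizer G P.out))).Finite ∧
    ∑ᶠ P ∈ (Quotient.mk (MulAction.orbitRel G X)) '' U,
      2 * (h P.out : ℚ) / Nat.card (MulAction.stabilizer G P.out) =
      2 / Nat.card (MulAction.stabilizer G p) * ((∑ᶠ z ∈ U, h z : ℤ) : ℚ) := by
  classical
  set π := Quotient.mk (MulAction.orbitRel G X) with hπ
  have hout : ∀ z : X, ∃ g : G, g • (π z).out = z := fun z ↦ by
    have : π (π z).out = π z := Quotient.out_eq _
    obtain ⟨g, hg⟩ := (Quotient.eq.1 this.symm : MulAction.orbitRel G X z (π z).out)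
    exact ⟨g, hg⟩
  have hh : ∀ z, h (π z).out = h z := fun z ↦ by
    obtain ⟨g, hg⟩ := hout z
    rw [← hinv g, hg]
  have hs : ∀ z, Nat.card (MulAction.stabilizer G (π z).out) =
      Nat.card (MulAction.stabilizer G z) := fun z ↦ by
    obtain ⟨g, hg⟩ := hout z
    exact Nat.card_congr (MulAction.stabilizerEquivStabilizer (g := g) hg.symm).toEquiv
  set t := hsupp.toFinset with ht
  have htmem : ∀ z, z ∈ t ↔ z ∈ U ∧ h z ≠ 0 := fun z ↦ by simp [ht]
  have hsub : (π '' U) ∩ Function.support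
      (fun P ↦ 2 * (h P.out : ℚ) / Nat.card (MulAction.stabilizer G P.out)) ⊆ ↑(t.image π) := by
    rintro _ ⟨⟨z, hz, rfl⟩, hne⟩
    rw [Finset.coe_image]
    refine ⟨z, (htmem z).2 ⟨hz, fun h0 ↦ hne ?_⟩, rfl⟩
    simp [hh, h0]
  refine ⟨(Finset.finite_toSet _).subset hsub, ?_⟩
  rw [finsum_mem_eq_sum_of_inter_support_eq (t := t.image π),
    finsum_mem_eq_sum_of_inter_support_eq (t := t) h (by simp [ht]),
    ← Finset.sum_fiberwise_of_maps_to (g := π) (t := t.image π)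
      (fun z hz ↦ Finset.mem_image_of_mem _ hz), Int.cast_sum, Finset.mul_sum]
  · refine Finset.sum_congr rfl fun P hP ↦ ?_
    obtain ⟨z, hz, rfl⟩ := Finset.mem_image.1 hP
    obtain ⟨hzU, hz0⟩ := (htmem z).1 hz
    -- The points of the support in `U` with the same orbit as `z` form one orbit of the stabilizer
    -- of `p`. There are |G_p| / |G_z| of them, which converts the weight 2 / |G_z| of the orbit
    -- into 2 / |G_p| per point.
    have hfilter : (↑(t.filter (fun x ↦ π x = π z)) : Set X) =
        MulAction.orbit (MulAction.stabilizer G p) z := by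
      ext x
      rw [Finset.mem_coe, Finset.mem_filter, htmem]
      constructor
      · rintro ⟨⟨hxU, hx0⟩, hx⟩
        obtain ⟨g, rfl⟩ := (Quotient.eq.1 hx : MulAction.orbitRel G X x z)
        exact ⟨⟨g, hU g z hzU hxU⟩, rfl⟩
      · rintro ⟨g, rfl⟩
        change ((g.1 • z ∈ U) ∧ h (g.1 • z) ≠ 0) ∧ π (g.1 • z) = π z
        exact ⟨⟨hU' _ g.2 _ hzU, by rwa [hinv]⟩, Quotient.sound ⟨g.1, rfl⟩⟩
    have hcard : ((t.filter (fun x ↦ π x = π z)).card : ℚ) *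
        Nat.card (MulAction.stabilizer G z) = Nat.card (MulAction.stabilizer G p) := by
      rw [card_stabilizer_eq_card_orbit_mul (z := z) (p := p)
        (fun g hg ↦ hU g z hzU (by rwa [hg])), ← hfilter, Set.ncard_coe_finset]
      push_cast
      rfl
    have hconst : ∑ x ∈ t.filter (fun x ↦ π x = π z), h x =
        (t.filter (fun x ↦ π x = π z)).card * h z := by
      rw [Finset.sum_congr rfl (g := fun _ ↦ h z), Finset.sum_const, nsmul_eq_mul]
      intro x hx
      rw [← hh x, (Finset.mem_filter.1 hx).2, hh]
    have hp0 : (Nat.card (MulAction.stabilizer G p) : ℚ) ≠ 0 := by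
      exact_mod_cast Nat.card_pos.ne'
    have hz0' : (Nat.card (MulAction.stabilizer G z) : ℚ) ≠ 0 := by
      intro h0
      rw [h0, mul_zero] at hcard
      exact hp0 hcard.symm
    rw [hh, hs, hconst]
    push_cast
    rw [div_eq_iff hz0', mul_comm (2 / _ : ℚ), mul_assoc, mul_assoc,
      div_mul_eq_mul_div, ← mul_div_assoc, ← mul_div_assoc, eq_div_iff hp0, ← hcard]
    ring
  · refine Set.Subset.antisymm (fun P hP ↦ ⟨hsub hP, hP.2⟩) ?_
    rintro P ⟨hP, hP'⟩
    refine ⟨?_, hP'⟩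
    obtain ⟨z, hz, rfl⟩ := Finset.mem_image.1 (Finset.mem_coe.1 hP)
    exact ⟨z, ((htmem z).1 hz).1, rfl⟩

end OrbitSum

/-! ### Invariant meromorphic functions near points of ℍ and near the cusp. -/

namespace Fricke

theorem map_coe_nhdsNE (z : ℍ) : map ((↑) : ℍ → ℂ) (𝓝[≠] z) = 𝓝[≠] (z : ℂ) := by
  have h : (UpperHalfPlane.coe ⁻¹' {(z : ℂ)}ᶜ) = {z}ᶜ := by ext; simp
  rw [← isOpenEmbedding_coe.map_nhdsWithin_preimage_eq, h]

theorem eventually_codiscrete_iff {p : ℍ → Prop} :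
    (∀ᶠ z in codiscrete ℍ, p z) ↔ ∀ z : ℍ, ∀ᶠ y in 𝓝[≠] (z : ℂ), p (ofComplex y) := by
  have h : ∀ z : ℍ, (∀ᶠ y in 𝓝[≠] z, p y) ↔ ∀ᶠ y in 𝓝[≠] (z : ℂ), p (ofComplex y) := by
    intro z
    rw [← map_coe_nhdsNE, eventually_map]
    simp
  simp only [← h]
  change {z | p z} ∈ codiscreteWithin Set.univ ↔ _
  rw [mem_codiscreteWithin_iff_forall_mem_nhdsNE]
  simp
  rfl

/-- A Möbius map is a local coordinate change, and the automorphy factor is analytic without zeros.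
-/
theorem order_smul_of_eventually {φ : ℍ → ℂ} {γ : SL(2, ℝ)} {k : ℤ}
    (h : ∀ᶠ z in codiscrete ℍ, φ (γ • z) = ((γ 1 0 : ℂ) * (z : ℂ) + (γ 1 1 : ℂ)) ^ k * φ z)
    (z : ℍ) : order φ (γ • z) = order φ z := by
  set m : ℂ → ℂ := fun y ↦ ((γ 0 0 : ℂ) * y + (γ 0 1 : ℂ)) / ((γ 1 0 : ℂ) * y + (γ 1 1 : ℂ)) with hm
  have hd := denom_ne_zero γ z
  have hma : AnalyticAt ℂ m z := by fun_prop (disch := exact hd)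
  have hmz : m z = (γ • z : ℍ) := (coe_smul_eq γ z).symm
  have hderiv : deriv m z ≠ 0 := by
    have h1 : HasDerivAt m (((γ 0 0 : ℂ) * ((γ 1 0 : ℂ) * z + (γ 1 1 : ℂ)) -
        ((γ 0 0 : ℂ) * z + (γ 0 1 : ℂ)) * (γ 1 0 : ℂ)) / ((γ 1 0 : ℂ) * z + (γ 1 1 : ℂ)) ^ 2) z := by
      refine HasDerivAt.div ?_ ?_ hd
      · simpa using ((hasDerivAt_id (z : ℂ)).const_mul (γ 0 0 : ℂ)).add_const (γ 0 1 : ℂ)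
      · simpa using ((hasDerivAt_id (z : ℂ)).const_mul (γ 1 0 : ℂ)).add_const (γ 1 1 : ℂ)
    rw [h1.deriv]
    refine div_ne_zero ?_ (pow_ne_zero 2 hd)
    have hdet : (γ 0 0 : ℂ) * γ 1 1 - γ 0 1 * γ 1 0 = 1 := by exact_mod_cast det_eq γ
    intro h0
    have : (1 : ℂ) = 0 := by linear_combination h0 - hdet
    exact one_ne_zero this
  have hcomp := meromorphicOrderAt_comp_of_deriv_ne_zero (f := φ ∘ ofComplex) hma hderiv
  rw [hmz] at hcomp
  rw [order, ← hcomp, order]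
  have hja : AnalyticAt ℂ (fun y : ℂ ↦ ((γ 1 0 : ℂ) * y + (γ 1 1 : ℂ)) ^ k) z :=
    AnalyticAt.fun_zpow (by fun_prop) hd
  rw [← meromorphicOrderAt_mul_of_ne_zero (f := φ ∘ ofComplex) hja (zpow_ne_zero k hd)]
  apply meromorphicOrderAt_congr
  filter_upwards [eventually_codiscrete_iff.1 h z,
    nhdsWithin_le_nhds (isOpen_upperHalfPlaneSet.mem_nhds z.2)] with y hy hy'
  have hof : ofComplex y = ⟨y, hy'⟩ := ofComplex_apply_of_im_pos hy'
  have : m y = (γ • ofComplex y : ℍ) := by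
    rw [coe_smul_eq, hof]
  simp only [Function.comp_apply, Pi.mul_apply, this, ofComplex_apply]
  rw [hy, hof]

/-- A meromorphic function `φ` on `ℍ`, invariant under `Γ₀*(7)`, with expansion `F` at `∞`. -/
structure IsInvariantPair (φ : ℍ → ℂ) (F : ℂ → ℂ) : Prop where
  meromorphic : MeromorphicOn (φ ∘ ofComplex) upperHalfPlaneSet
  invariant : ∀ γ ∈ frickeGroup 7, ∀ᶠ z in codiscrete ℍ, φ (γ • z) = φ z
  meromorphic_infty : MeromorphicAt F 0
  expansion : ∃ Y : ℝ, ∀ z : ℍ, Y < z.im →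
    φ ∘ ofComplex =ᶠ[𝓝[≠] (z : ℂ)] F ∘ Function.Periodic.qParam 1

theorem IsInvariantPair.order_smul {φ : ℍ → ℂ} {F : ℂ → ℂ} (h : IsInvariantPair φ F)
    {γ : SL(2, ℝ)} (hγ : γ ∈ frickeGroup 7) (z : ℍ) : order φ (γ • z) = order φ z :=
  order_smul_of_eventually (k := 0) (by simpa using h.invariant γ hγ) z

theorem isInvariantPair_const (c : ℂ) : IsInvariantPair (fun _ ↦ c) (fun _ ↦ c) where
  meromorphic z _ := MeromorphicAt.const c z
  invariant _ _ := by simp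
  meromorphic_infty := MeromorphicAt.const c 0
  expansion := ⟨0, fun _ _ ↦ Eventually.of_forall fun _ ↦ rfl⟩

theorem IsInvariantPair.comp₂ {φ ψ : ℍ → ℂ} {F G : ℂ → ℂ} (h : IsInvariantPair φ F)
    (h' : IsInvariantPair ψ G) (op : ℂ → ℂ → ℂ)
    (hop : ∀ (f g : ℂ → ℂ) (z : ℂ), MeromorphicAt f z → MeromorphicAt g z →
      MeromorphicAt (fun x ↦ op (f x) (g x)) z) :
    IsInvariantPair (fun z ↦ op (φ z) (ψ z)) (fun q ↦ op (F q) (G q)) where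
  meromorphic z hz := hop _ _ z (h.meromorphic z hz) (h'.meromorphic z hz)
  invariant γ hγ := by
    filter_upwards [h.invariant γ hγ, h'.invariant γ hγ] with z h1 h2
    rw [h1, h2]
  meromorphic_infty := hop _ _ _ h.meromorphic_infty h'.meromorphic_infty
  expansion := by
    obtain ⟨Y, hY⟩ := h.expansion
    obtain ⟨Y', hY'⟩ := h'.expansion
    refine ⟨max Y Y', fun z hz ↦ ?_⟩
    filter_upwards [hY z ((le_max_left _ _).trans_lt hz),
      hY' z ((le_max_right _ _).trans_lt hz)] with y h1 h2
    simp only [Function.comp_apply] at h1 h2 ⊢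
    rw [h1, h2]

theorem IsInvariantPair.sub_const {φ : ℍ → ℂ} {F : ℂ → ℂ} (h : IsInvariantPair φ F) (c : ℂ) :
    IsInvariantPair (fun z ↦ φ z - c) (fun q ↦ F q - c) :=
  h.comp₂ (isInvariantPair_const c) (fun x y ↦ x - y) fun _ _ _ hf hg ↦ hf.sub hg

theorem IsInvariantPair.inv {φ : ℍ → ℂ} {F : ℂ → ℂ} (h : IsInvariantPair φ F) :
    IsInvariantPair (fun z ↦ (φ z)⁻¹) (fun q ↦ (F q)⁻¹) :=
  h.comp₂ h (fun x _ ↦ x⁻¹) fun _ _ _ hf _ ↦ hf.inv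

theorem hasDerivAt_qParam (z : ℂ) : HasDerivAt (Function.Periodic.qParam 1)
    (Function.Periodic.qParam 1 z * (2 * Real.pi * Complex.I)) z := by
  have : HasDerivAt (fun z : ℂ ↦ 2 * Real.pi * Complex.I * z / (1 : ℝ))
      (2 * Real.pi * Complex.I) z := by
    simpa using (hasDerivAt_id z).const_mul (2 * Real.pi * Complex.I : ℂ)
  exact this.cexp

theorem meromorphicOrderAt_comp_qParam (F : ℂ → ℂ) (z : ℂ) :
    meromorphicOrderAt (F ∘ Function.Periodic.qParam 1) z =
      meromorphicOrderAt F (Function.Periodic.qParam 1 z) := by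
  refine meromorphicOrderAt_comp_of_deriv_ne_zero ?_ ?_
  · exact Function.Periodic.differentiable_qParam.analyticAt z
  · rw [(hasDerivAt_qParam z).deriv]
    exact mul_ne_zero (Function.Periodic.qParam_ne_zero z) Complex.two_pi_I_ne_zero

theorem order_ne_top_of_exists {φ : ℍ → ℂ}
    (h : MeromorphicOn (φ ∘ ofComplex) upperHalfPlaneSet) {w : ℍ} (hw : order φ w ≠ ⊤) (z : ℍ) :
    order φ z ≠ ⊤ :=
  h.meromorphicOrderAt_ne_top_of_isPreconnected (convex_halfSpace_im_gt 0).isPreconnected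
    w.2 z.2 hw

theorem qParam_mem_ball_iff {Y : ℝ} {z : ℂ} :
    Function.Periodic.qParam 1 z ∈ Metric.ball (0 : ℂ) (Real.exp (-2 * Real.pi * Y)) ↔ Y < z.im := by
  have := Function.Periodic.norm_qParam_lt_iff (h := 1) one_pos Y z
  rw [mem_ball_zero_iff]
  simpa using this

/-- The order of `φ` high up in `ℍ` is the order of its expansion. -/
theorem IsInvariantPair.exists_order_eq {φ : ℍ → ℂ} {F : ℂ → ℂ} (h : IsInvariantPair φ F) :
    ∃ Y : ℝ, ∀ (w : ℂ) (z : ℍ), Y < z.im → order (fun z ↦ φ z - w) z =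
      meromorphicOrderAt (fun q ↦ F q - w) (Function.Periodic.qParam 1 z) := by
  obtain ⟨Y, hY⟩ := h.expansion
  refine ⟨Y, fun w z hz ↦ ?_⟩
  rw [← meromorphicOrderAt_comp_qParam]
  refine meromorphicOrderAt_congr ?_
  filter_upwards [hY z hz] with y hy
  simp only [Function.comp_apply] at hy ⊢
  rw [hy]

/-- The contribution of an orbit to the change of the degree of `φ` on subtracting `w`. -/
noncomputable def jumpTerm (φ : ℍ → ℂ) (w : ℂ) (P : Orbits 7) : ℚ :=
  2 * (orderJump (φ ∘ ofComplex) w P.out : ℚ) / isotropyOrder P.out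

section

variable {φ : ℍ → ℂ} {F : ℂ → ℂ}

theorem IsInvariantPair.orderJump_smul (h : IsInvariantPair φ F) {γ : SL(2, ℝ)}
    (hγ : γ ∈ frickeGroup 7) (w : ℂ) (z : ℍ) :
    orderJump (φ ∘ ofComplex) w (γ • z : ℍ) = orderJump (φ ∘ ofComplex) w z := by
  have h1 := (h.sub_const w).order_smul hγ z
  have h2 := h.order_smul hγ z
  unfold order at h1 h2
  unfold orderJump
  rw [h2]
  exact congrArg (fun n : WithTop ℤ ↦ n.untop₀ - _) h1

theorem IsInvariantPair.jumpTerm_orbit (h : IsInvariantPair φ F) (w : ℂ) (z : ℍ) :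
    jumpTerm φ w (orbit 7 z) = 2 * (orderJump (φ ∘ ofComplex) w z : ℚ) / isotropyOrder z := by
  obtain ⟨γ, hγ, hz⟩ := orbit_eq_orbit_iff.1 (orbit_out (orbit 7 z))
  rw [jumpTerm, ← hz, h.orderJump_smul hγ, isotropyOrder_smul hγ]

/-- U is a small hyperbolic ball: stabilizers act by isometries and preserve it, and proper
discontinuity lets only them map a point of U into U. The height bound B keeps its orbits out of a
neighbourhood of the cusp. -/
theorem IsInvariantPair.exists_isOpen_finsum_jumpTerm (h : IsInvariantPair φ F) {p : ℍ}
    (hp : order φ p ≠ ⊤) {V : Set ℍ} (hV : V ∈ 𝓝 p) :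
    ∃ U ⊆ V, IsOpen U ∧ p ∈ U ∧ (∃ B : ℝ, ∀ z ∈ U, ∀ γ ∈ frickeGroup 7, (γ • z).im ≤ B) ∧
      ∀ᶠ w in 𝓝 0, (orbit 7 '' U ∩ Function.support (jumpTerm φ w)).Finite ∧
        ∑ᶠ P ∈ orbit 7 '' U, jumpTerm φ w P = 0 := by
  obtain ⟨U₁, hU₁, hfix⟩ :=
    ProperlyDiscontinuousSMul.exists_nhds_image_smul_eq_self (frickeGroup 7) p
  obtain ⟨U₀, hU₀, hloc⟩ := exists_nhds_finsum_orderJump_eq_zero (h.meromorphic p p.2) hp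
  have hU₀' : UpperHalfPlane.coe ⁻¹' U₀ ∈ 𝓝 p := continuous_coe.continuousAt.preimage_mem_nhds hU₀
  have him : {z : ℍ | p.im / 2 < z.im ∧ z.im < 2 * p.im} ∈ 𝓝 p :=
    ((isOpen_lt continuous_const continuous_im).inter
      (isOpen_lt continuous_im continuous_const)).mem_nhds
      ⟨half_lt_self p.im_pos, lt_two_mul_self p.im_pos⟩
  obtain ⟨r, hr, hball⟩ :=
    Metric.mem_nhds_iff.1 (inter_mem (inter_mem hV hU₁) (inter_mem hU₀' him))
  refine ⟨Metric.ball p r, fun z hz ↦ (hball hz).1.1, Metric.isOpen_ball, Metric.mem_ball_self hr,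
    ⟨max (2 * p.im) (1 / (7 * (p.im / 2))), fun z hz γ hγ ↦ ?_⟩, ?_⟩
  · obtain ⟨h1, h2⟩ := (hball hz).2.2
    have hp0 := p.im_pos
    refine (im_smul_le_max hγ z).trans (max_le_max h2.le ?_)
    gcongr
  · have hopen : UpperHalfPlane.coe '' Metric.ball p r ∈ 𝓝 (p : ℂ) :=
      (isOpenEmbedding_coe.isOpenMap _ Metric.isOpen_ball).mem_nhds
        ⟨p, Metric.mem_ball_self hr, rfl⟩
    have hsub : UpperHalfPlane.coe '' Metric.ball p r ⊆ U₀ := by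
      rintro _ ⟨z, hz, rfl⟩
      exact (hball hz).2.1
    filter_upwards [hloc _ hsub hopen] with w ⟨hfin, hsum⟩
    rw [finsum_mem_image coe_injective.injOn] at hsum
    have hfin' : (Metric.ball p r ∩
        Function.support (fun z : ℍ ↦ orderJump (φ ∘ ofComplex) w z)).Finite := by
      refine Set.Finite.of_finite_image (f := UpperHalfPlane.coe) (hfin.subset ?_)
        coe_injective.injOn
      rintro _ ⟨z, ⟨hz, hz'⟩, rfl⟩
      exact ⟨⟨z, hz, rfl⟩, hz'⟩
    have key := finsum_orbit_div_card_stabilizer (G := frickeGroup 7) (p := p)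
      (U := Metric.ball p r) (h := fun z : ℍ ↦ orderJump (φ ∘ ofComplex) w z)
      (ProperlyDiscontinuousSMul.finite_stabilizer p)
      (fun g z hz hgz ↦ hfix g ⟨_, ⟨z, (hball hz).1.2, rfl⟩, (hball hgz).1.2⟩)
      (fun g hg z hz ↦ by
        rw [Metric.mem_ball] at hz ⊢
        have : dist (g.1 • z) (g.1 • p) = dist z p := dist_smul _ _ _
        have hg' : g.1 • p = p := hg
        rw [hg'] at this
        exact this.trans_lt hz)
      (fun g z ↦ h.orderJump_smul g.2 w z) hfin'
    refine ⟨key.1, key.2.trans ?_⟩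
    rw [hsum]
    simp

theorem apply_eq_zero_of_one_lt_im {γ : SL(2, ℝ)} (hγ : γ ∈ frickeGroup 7) {z : ℍ}
    (hz : 1 < z.im) (hz' : 1 < (γ • z).im) : γ 1 0 = 0 := by
  by_contra hne
  have h1 := im_smul_le hγ hne z
  have h2 : 1 / (7 * z.im) < 1 := by
    rw [div_lt_one (by positivity)]
    linarith
  linarith

theorem qParam_eq_of_orbit_eq {z z' : ℍ} (hz : 1 < z.im) (hz' : 1 < z'.im)
    (h : orbit 7 z = orbit 7 z') :
    Function.Periodic.qParam 1 z = Function.Periodic.qParam 1 z' := by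
  obtain ⟨γ, hγ, rfl⟩ := orbit_eq_orbit_iff.1 h
  have key : ∀ n : ℤ, Function.Periodic.qParam 1 ((translation n • z' : ℍ) : ℂ) =
      Function.Periodic.qParam 1 z' := fun n ↦ by
    rw [coe_translation_smul, Function.Periodic.qParam, Function.Periodic.qParam,
      Complex.exp_eq_exp_iff_exists_int]
    exact ⟨n, by push_cast; ring⟩
  obtain ⟨n, rfl | rfl⟩ :=
    eq_translation_of_apply_eq_zero hγ (apply_eq_zero_of_one_lt_im hγ hz' hz)
  · exact key n
  · rw [neg_smul_eq]
    exact key n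

theorem isotropyOrder_of_one_lt_im {z : ℍ} (hz : 1 < z.im) : isotropyOrder z = 2 :=
  isotropyOrder_eq_two fun _ hγ hfix ↦ apply_eq_zero_of_one_lt_im hγ hz (by rwa [hfix])

theorem eventually_meromorphicOrderAt_eq_zero {g : ℂ → ℂ} {z : ℂ} (hg : MeromorphicAt g z)
    (h : meromorphicOrderAt g z ≠ ⊤) : ∀ᶠ x in 𝓝[≠] z, meromorphicOrderAt g x = 0 := by
  filter_upwards [hg.eventually_analyticAt,
    (meromorphicOrderAt_ne_top_iff_eventually_ne_zero hg).1 h] with x hx hx'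
  rw [hx.meromorphicOrderAt_eq, hx.analyticOrderAt_eq_zero.2 hx']
  rfl

/-- Above height 1 the only identifications are translations, so q maps these orbits bijectively to
a punctured disc, and their weight is 2/2 = 1. The local statement for F on the whole disc then has
the cusp as its term q = 0. -/
theorem IsInvariantPair.exists_finsum_jumpTerm_cusp (h : IsInvariantPair φ F)
    (hF : meromorphicOrderAt F 0 ≠ ⊤) (B : ℝ) :
    ∃ Y > B, (∀ z : ℍ, Y < z.im → order φ z = 0) ∧
      ∀ᶠ w in 𝓝 0, (orbit 7 '' {z | Y < z.im} ∩ Function.support (jumpTerm φ w)).Finite ∧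
        ∑ᶠ P ∈ orbit 7 '' {z | Y < z.im}, jumpTerm φ w P + orderJump F w 0 = 0 := by
  obtain ⟨U₀, hU₀, hloc⟩ := exists_nhds_finsum_orderJump_eq_zero h.meromorphic_infty hF
  obtain ⟨Y₀, hY₀⟩ := h.exists_order_eq
  have hord : ∀ᶠ q in 𝓝 (0 : ℂ), q ≠ 0 → meromorphicOrderAt F q = 0 :=
    eventually_nhdsWithin_iff.1 (eventually_meromorphicOrderAt_eq_zero h.meromorphic_infty hF)
  obtain ⟨ε, hε, hball⟩ := Metric.mem_nhds_iff.1 (inter_mem hU₀ hord)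
  obtain ⟨Y, ⟨hYB, hY1, hYY⟩, hYε⟩ : ∃ Y : ℝ, (B < Y ∧ 1 < Y ∧ Y₀ < Y) ∧
      Real.exp (-2 * Real.pi * Y) < ε := by
    have ht : Tendsto (fun Y : ℝ ↦ Real.exp (-2 * Real.pi * Y)) atTop (𝓝 0) := by
      refine Real.tendsto_exp_atBot.comp (tendsto_id.const_mul_atTop_of_neg ?_)
      linarith [Real.pi_pos]
    exact (((eventually_gt_atTop B).and ((eventually_gt_atTop 1).and
      (eventually_gt_atTop Y₀))).and (ht.eventually (gt_mem_nhds hε))).exists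
  set r := Real.exp (-2 * Real.pi * Y) with hr
  have hr0 : 0 < r := Real.exp_pos _
  have hsub : Metric.ball (0 : ℂ) r ⊆ Metric.ball 0 ε := Metric.ball_subset_ball hYε.le
  have hmem : ∀ z : ℍ, Y < z.im → Function.Periodic.qParam 1 z ∈ Metric.ball (0 : ℂ) r \ {0} :=
    fun z hz ↦ ⟨qParam_mem_ball_iff.2 hz, Function.Periodic.qParam_ne_zero _⟩
  have hjump : ∀ w, ∀ z : ℍ, Y < z.im → orderJump (φ ∘ ofComplex) w z =
      orderJump F w (Function.Periodic.qParam 1 z) := fun w z hz ↦ by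
    have h1 := hY₀ w z (hYY.trans hz)
    have h2 := hY₀ 0 z (hYY.trans hz)
    simp only [sub_zero] at h2
    unfold orderJump
    rw [← h1, ← h2]
    rfl
  refine ⟨Y, hYB, fun z hz ↦ ?_, ?_⟩
  · have h2 := hY₀ 0 z (hYY.trans hz)
    simp only [sub_zero] at h2
    rw [h2]
    exact (hball (hsub (hmem z hz).1)).2 (hmem z hz).2
  · set e : ℂ → Orbits 7 := fun q ↦ orbit 7 (ofComplex (Function.Periodic.invQParam 1 q)) with he
    have hq : ∀ q ∈ Metric.ball (0 : ℂ) r \ {0},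
        Y < (ofComplex (Function.Periodic.invQParam 1 q)).im ∧
        Function.Periodic.qParam 1 (ofComplex (Function.Periodic.invQParam 1 q)) = q := by
      rintro q ⟨hq, hq0⟩
      have h1 := Function.Periodic.qParam_right_inv (h := 1) one_ne_zero hq0
      have h2 : Y < (Function.Periodic.invQParam 1 q).im := by
        rw [← qParam_mem_ball_iff, h1]
        exact hq
      have h3 : 0 < (Function.Periodic.invQParam 1 q).im := by linarith
      rw [ofComplex_apply_of_im_pos h3]
      exact ⟨h2, h1⟩
    have hbij : Set.BijOn e (Metric.ball (0 : ℂ) r \ {0}) (orbit 7 '' {z | Y < z.im}) := by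
      refine ⟨fun q hq' ↦ ⟨_, (hq q hq').1, rfl⟩, fun q hq' q' hq'' heq ↦ ?_, ?_⟩
      · rw [← (hq q hq').2, ← (hq q' hq'').2]
        exact qParam_eq_of_orbit_eq (hY1.trans (hq q hq').1) (hY1.trans (hq q' hq'').1) heq
      · rintro _ ⟨z, hz, rfl⟩
        refine ⟨_, hmem z hz, ?_⟩
        obtain ⟨m, hm⟩ := Function.Periodic.qParam_left_inv_mod_period (h := 1) one_ne_zero (z : ℂ)
        have : ofComplex (Function.Periodic.invQParam 1 (Function.Periodic.qParam 1 z)) =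
            translation m • z := by
          rw [hm, ← ofComplex_apply (translation m • z), coe_translation_smul]
          simp
        simp only [he]
        rw [this, orbit_smul (translation_mem m)]
    have hterm : ∀ w, ∀ q ∈ Metric.ball (0 : ℂ) r \ {0},
        (orderJump F w q : ℚ) = jumpTerm φ w (e q) := by
      intro w q hq'
      obtain ⟨h1, h2⟩ := hq q hq'
      rw [he, h.jumpTerm_orbit, isotropyOrder_of_one_lt_im (hY1.trans h1), hjump w _ h1, h2]
      push_cast
      ring
    filter_upwards [hloc _ (hsub.trans fun q hq ↦ (hball hq).1) (Metric.ball_mem_nhds 0 hr0)]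
      with w ⟨hfin, hsum⟩
    have hfin' : ((Metric.ball (0 : ℂ) r \ {0}) ∩
        Function.support (fun q ↦ (orderJump F w q : ℚ))).Finite := by
      refine hfin.subset ?_
      rintro q ⟨⟨h1, -⟩, h2⟩
      exact ⟨h1, by simpa using h2⟩
    constructor
    · refine (hfin'.image e).subset ?_
      rintro P ⟨hP, hP'⟩
      obtain ⟨q, hq', rfl⟩ := hbij.surjOn hP
      exact ⟨q, ⟨hq', by rwa [Function.mem_support, hterm w q hq']⟩, rfl⟩
    · rw [← finsum_mem_eq_of_bijOn e hbij (hterm w), add_comm,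
        ← finsum_mem_insert' (fun q ↦ (orderJump F w q : ℚ)) (by simp) hfin', Set.insert_sdiff_singleton,
        Set.insert_eq_of_mem (Metric.mem_ball_self hr0)]
      have := congrArg (Int.cast : ℤ → ℚ) hsum
      rw [Int.cast_zero] at this
      rw [← this]
      exact ((Int.castAddHom ℚ).map_finsum_mem' hfin).symm

end

section

variable {φ : ℍ → ℂ} {F : ℂ → ℂ}

/-- The orders of F at 0 and at nearby q ≠ 0 are finite together; the latter are orders of φ high up
in ℍ, and the identity theorem spreads finiteness over ℍ. -/
theorem IsInvariantPair.infty_ne_top_iff (h : IsInvariantPair φ F) :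
    meromorphicOrderAt F 0 ≠ ⊤ ↔ ∀ z, order φ z ≠ ⊤ := by
  obtain ⟨Y, hY⟩ := h.exists_order_eq
  obtain ⟨s, hs, hF⟩ : ∃ s ∈ 𝓝 (0 : ℂ), ∀ q ∈ s, q ≠ 0 →
      (meromorphicOrderAt F q ≠ ⊤ ↔ meromorphicOrderAt F 0 ≠ ⊤) := by
    by_cases htop : meromorphicOrderAt F 0 = ⊤
    · refine ⟨_, eventually_nhds_eventually_nhdsNE (meromorphicOrderAt_eq_top_iff.1 htop),
        fun q hq _ ↦ ?_⟩
      simp only [ne_eq, htop, not_true_eq_false, iff_false, not_not]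
      exact meromorphicOrderAt_eq_top_iff.2 hq
    · refine ⟨_, eventually_nhdsWithin_iff.1
        (eventually_meromorphicOrderAt_eq_zero h.meromorphic_infty htop), fun q hq hq0 ↦ ?_⟩
      simp [hq hq0, htop]
  have hlim := (Function.Periodic.qParam_tendsto (h := 1) one_pos).mono_right nhdsWithin_le_nhds
  have him : ∀ᶠ z in comap Complex.im atTop, max Y 0 < z.im :=
    tendsto_comap.eventually (eventually_gt_atTop _)
  have : (comap Complex.im atTop).NeBot := comap_neBot fun t ht ↦ by
    obtain ⟨y, hy⟩ := (mem_atTop_sets.1 ht)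
    exact ⟨y * Complex.I, by simpa using hy y le_rfl⟩
  obtain ⟨x, hx, hxY⟩ := ((hlim.eventually_mem hs).and him).exists
  have hx0 : 0 < x.im := (le_max_right _ _).trans_lt hxY
  have key := hF _ hx (Function.Periodic.qParam_ne_zero x)
  have h2 := hY 0 ⟨x, hx0⟩ ((le_max_left _ _).trans_lt hxY)
  simp only [sub_zero] at h2
  rw [← key, ← h2]
  exact ⟨fun hz z ↦ order_ne_top_of_exists h.meromorphic hz z, fun hz ↦ hz _⟩

theorem IsInvariantPair.order_out (h : IsInvariantPair φ F) (z : ℍ) :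
    order φ (orbit 7 z).out = order φ z := by
  obtain ⟨γ, hγ, hz⟩ := orbit_eq_orbit_iff.1 (orbit_out (orbit 7 z))
  rw [← hz, h.order_smul hγ]

/-- Orders vanish high up, all other orbits meet a compact box, and zeros and poles are isolated. -/
theorem IsInvariantPair.finite_setOf_orbitOrder_ne_zero (h : IsInvariantPair φ F)
    (hφ : ∀ z, order φ z ≠ ⊤) : {P : Orbits 7 | order φ P.out ≠ 0}.Finite := by
  obtain ⟨Y, -, hY, -⟩ := h.exists_finsum_jumpTerm_cusp (h.infty_ne_top_iff.2 hφ) 0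
  set K := {z : ℍ | |z.re| ≤ 1 / 2 ∧ 1 / 10 ≤ z.im ∧ z.im ≤ Y}
  have hK : IsCompact K := isCompact_setOf_re_im _ _ (by norm_num)
  have hfin : (K ∩ {z | order φ z ≠ 0}).Finite := by
    refine hK.induction_on (p := fun s ↦ (s ∩ {z | order φ z ≠ 0}).Finite) (by simp)
      (fun s t hst ht ↦ ht.subset (Set.inter_subset_inter_left _ hst))
      (fun s t hs ht ↦ by rw [Set.union_inter_distrib_right]; exact hs.union ht) fun z _ ↦ ?_
    have h1 := eventually_meromorphicOrderAt_eq_zero (h.meromorphic z z.2) (hφ z)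
    rw [← map_coe_nhdsNE, eventually_map, eventually_nhdsWithin_iff] at h1
    refine ⟨_, nhdsWithin_le_nhds h1, (Set.finite_singleton z).subset ?_⟩
    rintro x ⟨hx, hx'⟩
    by_contra hne
    exact hx' (hx hne)
  refine (hfin.image (orbit 7)).subset fun P hP ↦ ?_
  obtain ⟨γ, hγ, hred⟩ := exists_smul_isReduced P.out
  refine ⟨γ • P.out, ⟨⟨hred.re_le, hred.one_div_ten_le_im, ?_⟩, ?_⟩, ?_⟩
  · by_contra! hlt
    exact hP (by rw [← h.order_smul hγ, hY _ hlt])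
  · simpa [h.order_smul hγ] using hP
  · rw [orbit_smul hγ, orbit_out]

/-- Local constancy of the degree, in terms of the contributions of the orbits. -/
theorem IsInvariantPair.eventually_finsum_jumpTerm (h : IsInvariantPair φ F)
    (hφ : ∀ z, order φ z ≠ ⊤) :
    ∀ᶠ w in 𝓝 0, ∑ᶠ P, jumpTerm φ w P + orderJump F w 0 = 0 := by
  have hF := h.infty_ne_top_iff.2 hφ
  -- Apart from the cusp, only zeros need a neighbourhood in which jumps cancel; poles keep their
  -- order.
  set S := {P : Orbits 7 | 0 < order φ P.out} with hS
  have hSfin : S.Finite :=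
    (h.finite_setOf_orbitOrder_ne_zero hφ).subset fun P hP ↦ (ne_of_lt hP).symm
  have hcont : Continuous (orbit 7) := continuous_quot_mk
  have hopen : IsOpenMap (orbit 7) := isOpenMap_quotient_mk'_mul (Γ := frickeGroup 7) (T := ℍ)
  obtain ⟨V, hV, hdisj⟩ := hSfin.t2_separation
  have hVn : ∀ P, orbit 7 ⁻¹' V P ∈ 𝓝 P.out := fun P ↦
    ((hV P).2.preimage hcont).mem_nhds (by rw [Set.mem_preimage, orbit_out]; exact (hV P).1)
  choose U hUV hUo hUp hB' hev using fun P : Orbits 7 ↦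
    h.exists_isOpen_finsum_jumpTerm (hφ P.out) (hVn P)
  choose B hB using hB'
  obtain ⟨B₀, hB₀⟩ := (hSfin.image B).bddAbove
  obtain ⟨Y, hYB, hYord, hYev⟩ := h.exists_finsum_jumpTerm_cusp hF B₀
  -- The rest of the fundamental domain is compact and carries no zero, so one bound on `w` makes
  -- all jumps there vanish.
  set C := {z : ℍ | |z.re| ≤ 1 / 2 ∧ 1 / 10 ≤ z.im ∧ z.im ≤ Y} \
    ⋃ P ∈ S, orbit 7 ⁻¹' (orbit 7 '' U P) with hC
  have hK : IsCompact {z : ℍ | |z.re| ≤ 1 / 2 ∧ 1 / 10 ≤ z.im ∧ z.im ≤ Y} :=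
    isCompact_setOf_re_im _ _ (by norm_num)
  have hCc : IsCompact C := hK.diff
    (isOpen_biUnion fun P _ ↦ (hopen _ (hUo P)).preimage hcont)
  have hCord : ∀ᶠ w in 𝓝 (0 : ℂ), ∀ z ∈ C, orderJump (φ ∘ ofComplex) w z = 0 := by
    refine hCc.eventually_forall_of_forall_eventually fun z hz ↦ ?_
    have hz0 : order φ z ≤ 0 := by
      by_contra! hlt
      refine hz.2 (Set.mem_biUnion (x := orbit 7 z) ?_ ?_)
      · rw [hS, Set.mem_ofPred_eq, h.order_out]
        exact hlt
      · exact ⟨_, hUp _, orbit_out _⟩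
    have h1 := eventually_meromorphicOrderAt_sub_const_eq (h.meromorphic z z.2) hz0
    have h2 : Tendsto (fun p : ℂ × ℍ ↦ (p.1, (p.2 : ℂ))) (𝓝 (0, z)) (𝓝 0 ×ˢ 𝓝 (z : ℂ)) := by
      rw [← nhds_prod_eq]
      exact (by fun_prop : Continuous (fun p : ℂ × ℍ ↦ (p.1, (p.2 : ℂ)))).tendsto _
    filter_upwards [h2.eventually h1] with p hp
    rw [orderJump, hp, sub_self]
  filter_upwards [hCord, hYev, (eventually_all_finite hSfin).2 fun P _ ↦ hev P]
    with w hw ⟨hYfin, hYsum⟩ hwS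
  set g := jumpTerm φ w
  have hsupp : Function.support g = (⋃ P ∈ S, orbit 7 '' U P ∩ Function.support g) ∪
      (orbit 7 '' {z | Y < z.im} ∩ Function.support g) := by
    refine Set.Subset.antisymm (fun P hP ↦ ?_) ?_
    · by_contra hcon
      simp only [Set.mem_union, Set.mem_iUnion, not_or, not_exists, Set.mem_inter_iff, not_and] at hcon
      obtain ⟨γ, hγ, hred⟩ := exists_smul_isReduced P.out
      have hPz : orbit 7 (γ • P.out) = P := by rw [orbit_smul hγ, orbit_out]
      refine hP ?_
      rw [← hPz]
      change jumpTerm φ w _ = 0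
      rw [h.jumpTerm_orbit, hw]
      · simp
      · refine ⟨⟨hred.re_le, hred.one_div_ten_le_im, ?_⟩, ?_⟩
        · by_contra! hlt
          exact hcon.2 ⟨_, hlt, hPz⟩ hP
        · simp only [Set.mem_iUnion, Set.mem_preimage, not_exists]
          intro Q hQ hmem
          rw [hPz] at hmem
          exact hcon.1 Q hQ hmem hP
    · exact Set.union_subset (Set.iUnion₂_subset fun P _ ↦ Set.inter_subset_right)
        Set.inter_subset_right
  -- `Y` exceeds the height bound of every `U P`.
  have hd1 : Disjoint (⋃ P ∈ S, orbit 7 '' U P ∩ Function.support g)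
      (orbit 7 '' {z | Y < z.im} ∩ Function.support g) := by
    rw [Set.disjoint_left]
    rintro Q hQ ⟨⟨z, hz, rfl⟩, -⟩
    simp only [Set.mem_iUnion, Set.mem_inter_iff] at hQ
    obtain ⟨P, hP, ⟨z', hz', heq⟩, -⟩ := hQ
    obtain ⟨γ, hγ, rfl⟩ := orbit_eq_orbit_iff.1 heq.symm
    have h1 := hB P z' hz' γ hγ
    have h2 : B P ≤ B₀ := hB₀ ⟨P, hP, rfl⟩
    exact absurd hz (not_lt.2 ((h1.trans h2).trans hYB.le))
  have hd2 : S.PairwiseDisjoint fun P ↦ orbit 7 '' U P ∩ Function.support g := by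
    refine hdisj.mono fun P ↦ Set.inter_subset_left.trans ?_
    rintro _ ⟨z, hz, rfl⟩
    exact hUV P hz
  rw [← finsum_mem_support g, hsupp, finsum_mem_union hd1
    (hSfin.biUnion fun P hP ↦ (hwS P hP).1) hYfin,
    finsum_mem_biUnion hd2 hSfin fun P hP ↦ (hwS P hP).1, finsum_mem_inter_support,
    finsum_mem_congr rfl fun P hP ↦ (finsum_mem_inter_support g _).trans (hwS P hP).2,
    finsum_mem_zero, zero_add, hYsum]

/-- The degree of the divisor of `φ` on the compactification of `Γ₀*(7) \ ℍ`. -/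
noncomputable def degree (φ : ℍ → ℂ) (F : ℂ → ℂ) : ℚ :=
  ((meromorphicOrderAt F 0).untop₀ : ℚ) +
    ∑ᶠ P : Orbits 7, 2 * (orbitOrder 7 φ P : ℚ) / isotropyOrder P.out

theorem IsInvariantPair.finite_support_term (h : IsInvariantPair φ F)
    (hφ : ∀ z, order φ z ≠ ⊤) :
    (Function.support fun P : Orbits 7 ↦
      2 * (orbitOrder 7 φ P : ℚ) / isotropyOrder P.out).Finite := by
  refine (h.finite_setOf_orbitOrder_ne_zero hφ).subset fun P hP hP0 ↦ hP ?_
  simp [orbitOrder, hP0]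

theorem IsInvariantPair.eventually_degree_sub_const_eq (h : IsInvariantPair φ F)
    (hφ : ∀ c z, order (fun z ↦ φ z - c) z ≠ ⊤) :
    ∀ᶠ w in 𝓝 0, degree (fun z ↦ φ z - w) (fun q ↦ F q - w) = degree φ F := by
  have hφ0 : ∀ z, order φ z ≠ ⊤ := by simpa using hφ 0
  filter_upwards [h.eventually_finsum_jumpTerm hφ0] with w hw
  have h1 := finsum_sub_distrib ((h.sub_const w).finite_support_term (hφ w))
    (h.finite_support_term hφ0)
  have h2 : ∀ P : Orbits 7, 2 * (orbitOrder 7 (fun z ↦ φ z - w) P : ℚ) / isotropyOrder P.out -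
      2 * (orbitOrder 7 φ P : ℚ) / isotropyOrder P.out = jumpTerm φ w P := fun P ↦ by
    rw [jumpTerm, orderJump, ← sub_div, ← mul_sub, ← Int.cast_sub]
    rfl
  rw [finsum_congr h2] at h1
  rw [orderJump] at hw
  push_cast at hw
  rw [degree, degree]
  linarith

theorem degree_eq_add {φ₁ φ₂ φ₃ : ℍ → ℂ} {F₁ F₂ F₃ : ℂ → ℂ} (h₁ : IsInvariantPair φ₁ F₁)
    (h₂ : IsInvariantPair φ₂ F₂) (hφ₁ : ∀ z, order φ₁ z ≠ ⊤) (hφ₂ : ∀ z, order φ₂ z ≠ ⊤)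
    (h : ∀ z, order φ₃ z = order φ₁ z + order φ₂ z)
    (hF : meromorphicOrderAt F₃ 0 = meromorphicOrderAt F₁ 0 + meromorphicOrderAt F₂ 0) :
    degree φ₃ F₃ = degree φ₁ F₁ + degree φ₂ F₂ := by
  have e := finsum_add_distrib (h₁.finite_support_term hφ₁) (h₂.finite_support_term hφ₂)
  have e2 : ∀ P : Orbits 7, 2 * (orbitOrder 7 φ₃ P : ℚ) / isotropyOrder P.out =
      2 * (orbitOrder 7 φ₁ P : ℚ) / isotropyOrder P.out +
      2 * (orbitOrder 7 φ₂ P : ℚ) / isotropyOrder P.out := fun P ↦ by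
    rw [orbitOrder, orbitOrder, orbitOrder, h, WithTop.untop₀_add (hφ₁ _) (hφ₂ _)]
    push_cast
    ring
  rw [degree, degree, degree, hF,
    WithTop.untop₀_add (h₁.infty_ne_top_iff.2 hφ₁) (h₂.infty_ne_top_iff.2 hφ₂), finsum_congr e2, e]
  push_cast
  ring

end

/-! ### The degree of an invariant function is zero. -/

/-- g - c = -c · g · (g⁻¹ - c⁻¹). -/
theorem meromorphicOrderAt_sub_const_eq_add {g : ℂ → ℂ} {z c : ℂ} (hg : MeromorphicAt g z)
    (h : meromorphicOrderAt g z ≠ ⊤) (hc : c ≠ 0) :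
    meromorphicOrderAt (fun x ↦ g x - c) z =
      meromorphicOrderAt g z + meromorphicOrderAt (fun x ↦ (g x)⁻¹ - c⁻¹) z := by
  have hm : MeromorphicAt (fun x ↦ (g x)⁻¹ - c⁻¹) z := hg.inv.sub (MeromorphicAt.const _ _)
  have ha : AnalyticAt ℂ (fun _ : ℂ ↦ -c) z := analyticAt_const
  rw [← meromorphicOrderAt_mul hg hm,
    ← meromorphicOrderAt_mul_of_ne_zero (f := g * _) ha (neg_ne_zero.2 hc)]
  apply meromorphicOrderAt_congr
  filter_upwards [(meromorphicOrderAt_ne_top_iff_eventually_ne_zero hg).1 h] with x hx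
  simp only [Pi.mul_apply]
  field_simp
  ring

section

variable {φ : ℍ → ℂ} {F : ℂ → ℂ}

theorem degree_eq_zero_of_order_eq_zero (h : ∀ z, order φ z = 0)
    (hF : meromorphicOrderAt F 0 = 0) : degree φ F = 0 := by
  simp [degree, orbitOrder, h, hF]

theorem IsInvariantPair.degree_inv_eq_zero (h : IsInvariantPair φ F)
    (hφ : ∀ z, order φ z ≠ ⊤) : degree (fun z ↦ (φ z)⁻¹) (fun q ↦ (F q)⁻¹) = 0 := by
  by_cases hconst : ∀ c z, order (fun z ↦ φ z - c) z ≠ ⊤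
  · have hinv : ∀ z, order (fun z ↦ (φ z)⁻¹) z ≠ ⊤ := fun z ↦ by
      have : order (fun z ↦ (φ z)⁻¹) z = - order φ z := meromorphicOrderAt_inv
      rw [this]
      have := hφ z
      lift order φ z to ℤ using this with n
      exact WithTop.coe_ne_top
    have key : ∀ c ≠ 0, ∀ z, order (fun z ↦ φ z - c) z =
        order φ z + order (fun z ↦ (φ z)⁻¹ - c⁻¹) z := fun c hc z ↦
      meromorphicOrderAt_sub_const_eq_add (h.meromorphic z z.2) (hφ z) hc
    have hinvc : ∀ c z, order (fun z ↦ (φ z)⁻¹ - c) z ≠ ⊤ := fun c z ↦ by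
      rcases eq_or_ne c 0 with rfl | hc
      · simpa using hinv z
      · intro htop
        have := key c⁻¹ (inv_ne_zero hc) z
        rw [inv_inv, htop] at this
        exact hconst _ _ (this.trans (by simp))
    have hloc : IsLocallyConstant fun c ↦ degree (fun z ↦ φ z - c) (fun q ↦ F q - c) := by
      rw [IsLocallyConstant.iff_eventually_eq]
      intro c
      have h1 := (h.sub_const c).eventually_degree_sub_const_eq
        (fun w z ↦ by simpa only [sub_sub] using hconst (c + w) z)
      have h2 : Tendsto (fun x ↦ x - c) (𝓝 c) (𝓝 0) := by
        simpa using (continuous_sub_right c).tendsto c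
      filter_upwards [h2.eventually h1] with x hx
      simpa only [sub_sub, add_sub_cancel] using hx
    have h1 := h.inv.eventually_degree_sub_const_eq hinvc
    -- A nonzero `w` so small that `φ⁻¹ - w` has the degree of `φ⁻¹`. Comparing the degrees of `φ -
    -- w⁻¹` and `φ` leaves 0 for it.
    obtain ⟨w, hw, hw0⟩ : ∃ w : ℂ, degree (fun z ↦ (φ z)⁻¹ - w) (fun q ↦ (F q)⁻¹ - w) =
        degree (fun z ↦ (φ z)⁻¹) (fun q ↦ (F q)⁻¹) ∧ w ≠ 0 :=
      ((h1.filter_mono nhdsWithin_le_nhds).and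
        (eventually_mem_nhdsWithin (a := (0 : ℂ)) (s := {0}ᶜ))).exists
    have hFk := meromorphicOrderAt_sub_const_eq_add h.meromorphic_infty
      (h.infty_ne_top_iff.2 hφ) (inv_ne_zero hw0)
    have h2 := degree_eq_add (φ₃ := fun z ↦ φ z - w⁻¹) (F₃ := fun q ↦ F q - w⁻¹) h
      (h.inv.sub_const w) hφ (hinvc w)
      (fun z ↦ by simpa using key w⁻¹ (inv_ne_zero hw0) z)
      (by simpa using hFk)
    have h3 := hloc.apply_eq_of_preconnectedSpace w⁻¹ 0
    simp only [sub_zero] at h3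
    linarith
  -- Otherwise `φ` is a nonzero constant off a discrete set, and all orders of its inverse are 0.
  · push Not at hconst
    obtain ⟨c, z₀, hz₀⟩ := hconst
    have htop : ∀ z, order (fun z ↦ φ z - c) z = ⊤ := fun z ↦ by
      by_contra hz
      exact order_ne_top_of_exists (h.sub_const c).meromorphic hz z₀ hz₀
    have hFtop : meromorphicOrderAt (fun q ↦ F q - c) 0 = ⊤ := by
      by_contra hF
      exact (h.sub_const c).infty_ne_top_iff.1 hF z₀ hz₀
    have hzero : ∀ {g : ℂ → ℂ} {x : ℂ}, meromorphicOrderAt g x ≠ ⊤ →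
        meromorphicOrderAt (fun x ↦ g x - c) x = ⊤ →
        meromorphicOrderAt (fun x ↦ (g x)⁻¹) x = 0 := by
      intro g x hg hgc
      have hgc' : g =ᶠ[𝓝[≠] x] fun _ ↦ c := by
        filter_upwards [meromorphicOrderAt_eq_top_iff.1 hgc] with y hy using sub_eq_zero.1 hy
      have hc0 : c ≠ 0 := by
        rintro rfl
        exact hg (meromorphicOrderAt_eq_top_iff.2 hgc')
      have e1 : (fun x ↦ (g x)⁻¹) =ᶠ[𝓝[≠] x] fun _ ↦ c⁻¹ := by
        filter_upwards [hgc'] with y hy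
        rw [hy]
      classical
      rw [meromorphicOrderAt_congr e1, meromorphicOrderAt_const, if_neg (inv_ne_zero hc0)]
    exact degree_eq_zero_of_order_eq_zero (fun z ↦ hzero (hφ z) (htop z))
      (hzero (h.infty_ne_top_iff.2 hφ) hFtop)

/-- An invariant meromorphic function has as many zeros as poles. -/
theorem IsInvariantPair.degree_eq_zero (h : IsInvariantPair φ F)
    (hφ : ∀ z, order φ z ≠ ⊤) : degree φ F = 0 := by
  have := h.inv.degree_inv_eq_zero fun z ↦ by
    have : order (fun z ↦ (φ z)⁻¹) z = - order φ z := meromorphicOrderAt_inv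
    rw [this]
    have := hφ z
    lift order φ z to ℤ using this with n
    exact WithTop.coe_ne_top
  simpa using this

end

/-! ### The form Δ(z)Δ(7z) of weight 24. -/

section Theta

/-- The discriminant, as a function on `ℂ`. -/
noncomputable def discr (z : ℂ) : ℂ := ModularForm.discriminant (ofComplex z)

theorem discr_moebius {a b c d : ℤ} (h : a * d - b * c = 1) {z : ℂ} (hz : 0 < z.im) :
    discr ((a * z + b) / (c * z + d)) = (c * z + d) ^ 12 * discr z := by
  have hdet : Matrix.det !![a, b; c, d] = 1 := by rw [Matrix.det_fin_two_of, h]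
  set A : SL(2, ℤ) := ⟨!![a, b; c, d], hdet⟩ with hA
  have h1 := congrFun (SlashInvariantForm.slash_action_generators_SL2Z
    ModularForm.discriminant_S_invariant ModularForm.discriminant_T_invariant A) ⟨z, hz⟩
  have hden : denom (A : GL (Fin 2) ℝ) (z : ℂ) = c * z + d := by
    rw [ModularGroup.denom_apply A ⟨z, hz⟩]
    simp [hA]
  have hsm : ((A • (⟨z, hz⟩ : ℍ) : ℍ) : ℂ) = (a * z + b) / (c * z + d) := by
    rw [specialLinearGroup_apply]
    simp [hA]
  have hden0 : (c * z + d : ℂ) ≠ 0 := by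
    have := UpperHalfPlane.denom_ne_zero (A : GL (Fin 2) ℝ) (⟨z, hz⟩ : ℍ)
    rwa [hden] at this
  rw [ModularForm.SL_slash_apply, hden, zpow_neg, mul_inv_eq_iff_eq_mul₀ (zpow_ne_zero _ hden0)] at h1
  rw [discr, ← hsm, ofComplex_apply, h1, discr, ofComplex_apply_of_im_pos hz, mul_comm]
  rfl

/-- The product `Δ(z) Δ(7z)`. -/
noncomputable def theta (z : ℂ) : ℂ := discr z * discr (7 * z)

/-- On Γ₀(7), 7γz is the image of 7z under (a, 7b; c, d). On the other coset the two factors are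
exchanged: γz is the image of 7z under (a, b; c, 7d), and 7γz that of z under (7a, b; c, d). The
stray 7¹² is √7²⁴. -/
theorem theta_smul {γ : SL(2, ℝ)} (hγ : γ ∈ frickeGroup 7) (z : ℍ) :
    theta (γ • z : ℍ) = ((γ 1 0 : ℂ) * (z : ℂ) + (γ 1 1 : ℂ)) ^ 24 * theta z := by
  have h7 : 0 < (7 * (z : ℂ)).im := by simpa using z.im_pos
  have hd := denom_ne_zero γ z
  rw [coe_smul_eq, theta, theta]
  rcases mem_frickeGroup_seven_iff.1 hγ with ⟨a, b, c, d, h0, h1, h2, h3, h4⟩ |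
    ⟨a, b, c, d, h0, h1, h2, h3, h4⟩
  · rw [h3, h4] at hd
    rw [h1, h2, h3, h4]
    push_cast at hd ⊢
    have e1 := discr_moebius (a := a) (b := b) (c := 7 * c) (d := d) (by linarith) z.im_pos
    have e2 := discr_moebius (a := a) (b := 7 * b) (c := c) (d := d) (by linarith) h7
    push_cast at e1 e2
    have e3 : 7 * ((a * (z : ℂ) + b) / (7 * c * z + d)) =
        (a * (7 * (z : ℂ)) + 7 * b) / (c * (7 * z) + d) := by
      rw [← mul_div_assoc]
      congr 1 <;> ring
    rw [e3, e2]
    rw [e1]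
    ring
  · rw [h3, h4] at hd
    rw [h1, h2, h3, h4]
    push_cast at hd ⊢
    have hs : ((√7 : ℝ) : ℂ) ≠ 0 := by exact_mod_cast sqrt_seven_ne_zero
    have hs2 : ((√7 : ℝ) : ℂ) * (√7 : ℝ) = 7 := by exact_mod_cast sqrt_seven_mul_self
    have e1 := discr_moebius (a := a) (b := b) (c := c) (d := 7 * d) (by linarith) h7
    have e2 := discr_moebius (a := 7 * a) (b := b) (c := c) (d := d) (by linarith) z.im_pos
    push_cast at e1 e2
    have hd' : (c * (z : ℂ) + d) ≠ 0 := by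
      intro h
      apply hd
      linear_combination ((√7 : ℝ) : ℂ) * h
    have hd7 : (c * (7 * (z : ℂ)) + 7 * d) ≠ 0 := by
      intro h
      apply hd'
      linear_combination h / 7
    have e3 : (((√7 : ℝ) : ℂ) * a * z + b / (√7 : ℝ)) / ((√7 : ℝ) * c * z + (√7 : ℝ) * d) =
        (a * (7 * (z : ℂ)) + b) / (c * (7 * z) + 7 * d) := by
      rw [div_eq_div_iff hd hd7]
      field_simp
      linear_combination (-(b * (c * z + d)) : ℂ) * hs2
    have e4 : 7 * ((a * (7 * (z : ℂ)) + b) / (c * (7 * z) + 7 * d)) =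
        (7 * a * (z : ℂ) + b) / (c * z + d) := by
      rw [← mul_div_assoc, div_eq_div_iff hd7 hd']
      ring
    rw [e3, e4, e1]
    rw [e2]
    have h24 : (((√7 : ℝ) : ℂ) * c * z + (√7 : ℝ) * d) ^ 24 = 7 ^ 12 * (c * (z : ℂ) + d) ^ 24 := by
      rw [← hs2]
      ring
    rw [h24]
    ring

theorem discr_ne_zero (z : ℂ) : discr z ≠ 0 := ModularForm.discriminant_ne_zero _

theorem theta_ne_zero (z : ℂ) : theta z ≠ 0 := mul_ne_zero (discr_ne_zero _) (discr_ne_zero _)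

theorem analyticAt_discr {z : ℂ} (hz : 0 < z.im) : AnalyticAt ℂ discr z := by
  have h : DifferentiableOn ℂ discr upperHalfPlaneSet := by
    refine .congr (fun z hz ↦ ((ModularForm.differentiableAt_eta_of_mem_upperHalfPlaneSet hz).pow
      24).differentiableWithinAt) fun z hz ↦ ?_
    simp [discr, ModularForm.discriminant, ofComplex_apply_of_im_pos hz]
  exact h.analyticAt (isOpen_upperHalfPlaneSet.mem_nhds hz)

theorem analyticAt_theta {z : ℂ} (hz : 0 < z.im) : AnalyticAt ℂ theta z :=
  (analyticAt_discr hz).mul ((analyticAt_discr (z := 7 * z) (by simpa using hz)).comp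
    (g := discr) (f := fun z ↦ 7 * z) (by fun_prop))

/-- The infinite product in the expansion of the discriminant. -/
noncomputable def eulerProd (q : ℂ) : ℂ := ∏' n : ℕ, (1 - q ^ (n + 1)) ^ 24

theorem eulerProd_zero : eulerProd 0 = 1 := by simp [eulerProd]

theorem analyticAt_eulerProd_zero : AnalyticAt ℂ eulerProd 0 :=
  (ModularForm.differentiableOn_tprod_one_sub_pow_pow 24).analyticAt
    (Metric.ball_mem_nhds _ one_pos)

theorem discr_eq {z : ℂ} (hz : 0 < z.im) :
    discr z = Function.Periodic.qParam 1 z * eulerProd (Function.Periodic.qParam 1 z) := by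
  rw [discr, ModularForm.discriminant_eq_q_prod, ofComplex_apply_of_im_pos hz]
  rfl

/-- The expansion of `theta` at infinity. -/
noncomputable def thetaExpansion (q : ℂ) : ℂ := q ^ 8 * (eulerProd q * eulerProd (q ^ 7))

theorem theta_eq {z : ℂ} (hz : 0 < z.im) :
    theta z = thetaExpansion (Function.Periodic.qParam 1 z) := by
  have h7 : Function.Periodic.qParam 1 (7 * z) = Function.Periodic.qParam 1 z ^ 7 := by
    rw [Function.Periodic.qParam, Function.Periodic.qParam, ← Complex.exp_nat_mul]
    congr 1
    push_cast
    ring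
  rw [theta, discr_eq hz, discr_eq (z := 7 * z) (by simpa using hz), h7, thetaExpansion]
  ring

theorem analyticAt_eulerProd_mul :
    AnalyticAt ℂ (fun q ↦ eulerProd q * eulerProd (q ^ 7)) 0 :=
  analyticAt_eulerProd_zero.mul (AnalyticAt.fun_comp (g := eulerProd) (f := fun q : ℂ ↦ q ^ 7)
    (by simpa using analyticAt_eulerProd_zero) (by fun_prop))

theorem meromorphicAt_thetaExpansion : MeromorphicAt thetaExpansion 0 :=
  (AnalyticAt.mul (by fun_prop) analyticAt_eulerProd_mul).meromorphicAt

theorem meromorphicOrderAt_thetaExpansion : meromorphicOrderAt thetaExpansion 0 = (8 : ℤ) := by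
  rw [meromorphicOrderAt_eq_int_iff meromorphicAt_thetaExpansion]
  refine ⟨_, analyticAt_eulerProd_mul, by simp [eulerProd_zero], Eventually.of_forall fun q ↦ ?_⟩
  simp [thetaExpansion, zpow_ofNat]

end Theta

/-! ### Reduction to weight zero. -/

section Expansion

variable {k : ℤ} {f : ℍ → ℂ}

/-- Periodicity of f holds only off a discrete set; functions in normal form that agree on a
punctured neighbourhood agree at its centre too. -/
theorem IsModularFunction.normalForm_add_int (hf : IsModularFunction 7 k f) {z : ℂ}
    (hz : 0 < z.im) (m : ℤ) : normalForm f (z + m) = normalForm f z := by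
  have hzm : 0 < (z + m).im := by simpa using hz
  have htend : Tendsto (fun y : ℂ ↦ y + m) (𝓝[≠] z) (𝓝[≠] (z + m)) := by
    refine tendsto_nhdsWithin_of_tendsto_nhds_of_eventually_within _
      (((continuous_add_const (m : ℂ)).tendsto z).mono_left nhdsWithin_le_nhds) ?_
    filter_upwards [self_mem_nhdsWithin] with y hy
    simpa using hy
  have h1 := htend.eventually (hf.meromorphic.toMeromorphicNFOn_eq_self_on_nhdsNE hzm)
  have h2 := hf.meromorphic.toMeromorphicNFOn_eq_self_on_nhdsNE hz
  have h3 := eventually_codiscrete_iff.1 (hf.transform _ (translation_mem m)) ⟨z, hz⟩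
  have h4 : normalForm f ∘ (· + (m : ℂ)) =ᶠ[𝓝[≠] z] normalForm f := by
    filter_upwards [h1, h2, h3, nhdsWithin_le_nhds (isOpen_upperHalfPlaneSet.mem_nhds hz)]
      with y h1 h2 h3 hy
    rw [normalForm, h2, Function.comp_apply, h1, Function.comp_apply, Function.comp_apply]
    have e : ofComplex (y + m) = translation m • ofComplex y := by
      ext
      rw [coe_translation_smul, ofComplex_apply_of_im_pos hy,
        ofComplex_apply_of_im_pos (by simpa using hy)]
    rw [e, h3]
    simp [coe_translation]
  have hNF : MeromorphicNFOn (normalForm f) upperHalfPlaneSet := 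
    meromorphicNFOn_toMeromorphicNFOn _ _
  rw [(meromorphicNFAt_comp_add_const_iff_meromorphicNFAt.2
    (hNF hzm)).eventuallyEq_nhdsNE_iff_eventuallyEq_nhds (hNF hz)] at h4
  exact h4.eq_of_nhds

theorem IsModularFunction.expansionAtInfty_qParam (hf : IsModularFunction 7 k f) {z : ℂ}
    (hz : 0 < z.im) : expansionAtInfty f (Function.Periodic.qParam 1 z) = normalForm f z := by
  rw [expansionAtInfty, Function.Periodic.cuspFunction_eq_of_nonzero _ _
    (Function.Periodic.qParam_ne_zero z)]
  obtain ⟨m, hm⟩ := Function.Periodic.qParam_left_inv_mod_period (h := 1) one_ne_zero z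
  rw [hm]
  simpa using hf.normalForm_add_int hz m

theorem IsModularFunction.comp_ofComplex_eq (hf : IsModularFunction 7 k f) (z : ℍ) :
    f ∘ ofComplex =ᶠ[𝓝[≠] (z : ℂ)] expansionAtInfty f ∘ Function.Periodic.qParam 1 := by
  filter_upwards [hf.meromorphic.toMeromorphicNFOn_eq_self_on_nhdsNE z.2,
    nhdsWithin_le_nhds (isOpen_upperHalfPlaneSet.mem_nhds z.2)] with y hy hy'
  rw [Function.comp_apply (f := expansionAtInfty f), hf.expansionAtInfty_qParam hy', normalForm, hy]

/-- The weight `0` function `f ^ 24 / theta ^ k`. -/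
noncomputable def weightZero (k : ℤ) (f : ℍ → ℂ) (z : ℍ) : ℂ := f z ^ 24 * (theta z ^ k)⁻¹

/-- The expansion of `weightZero k f` at infinity. -/
noncomputable def weightZeroExpansion (k : ℤ) (f : ℍ → ℂ) (q : ℂ) : ℂ :=
  expansionAtInfty f q ^ 24 * (thetaExpansion q ^ k)⁻¹

theorem weightZero_comp_ofComplex (z : ℍ) : weightZero k f ∘ ofComplex =ᶠ[𝓝[≠] (z : ℂ)]
    fun y ↦ (f ∘ ofComplex) y ^ 24 * (theta y ^ k)⁻¹ := by
  filter_upwards [nhdsWithin_le_nhds (isOpen_upperHalfPlaneSet.mem_nhds z.2)] with y hy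
  simp only [Function.comp_apply, weightZero]
  rw [ofComplex_apply_of_im_pos hy]

theorem IsModularFunction.isInvariantPair (hf : IsModularFunction 7 k f) :
    IsInvariantPair (weightZero k f) (weightZeroExpansion k f) where
  meromorphic z hz := by
    refine MeromorphicAt.congr ?_ (weightZero_comp_ofComplex ⟨z, hz⟩).symm
    exact ((hf.meromorphic z hz).pow 24).mul ((analyticAt_theta hz).meromorphicAt.zpow k).inv
  invariant γ hγ := by
    filter_upwards [hf.transform γ hγ] with z hz
    have hd := denom_ne_zero γ z
    have ht := theta_ne_zero z
    rw [weightZero, weightZero, hz, theta_smul hγ, mul_pow, mul_zpow, mul_inv,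
      ← zpow_natCast, ← zpow_mul, ← zpow_natCast ((_ : ℂ) + _) 24, ← zpow_mul, mul_comm k]
    have := zpow_ne_zero (((24 : ℕ) : ℤ) * k) hd
    field_simp
  meromorphic_infty := (hf.meromorphic_infty.pow 24).mul (meromorphicAt_thetaExpansion.zpow k).inv
  expansion := by
    refine ⟨0, fun z _ ↦ ?_⟩
    filter_upwards [weightZero_comp_ofComplex (k := k) (f := f) z, hf.comp_ofComplex_eq z,
      nhdsWithin_le_nhds (isOpen_upperHalfPlaneSet.mem_nhds z.2)] with y h1 h2 hy
    rw [h1, h2, theta_eq hy]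
    rfl

theorem IsModularFunction.order_weightZero (hf : IsModularFunction 7 k f) (z : ℍ) :
    order (weightZero k f) z = 24 * order f z := by
  rw [order, meromorphicOrderAt_congr (weightZero_comp_ofComplex z)]
  have ht : AnalyticAt ℂ (fun y ↦ (theta y ^ k)⁻¹) z :=
    (AnalyticAt.fun_zpow (analyticAt_theta z.2) (theta_ne_zero _)).fun_inv
      (zpow_ne_zero k (theta_ne_zero _))
  have hm : (fun y ↦ (f ∘ ofComplex) y ^ 24 * (theta y ^ k)⁻¹) =
    (fun y ↦ (theta y ^ k)⁻¹) * (f ∘ ofComplex) ^ 24 := by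
    ext y
    simp [mul_comm]
  rw [hm, meromorphicOrderAt_mul_of_ne_zero ht (inv_ne_zero (zpow_ne_zero k (theta_ne_zero _))),
    meromorphicOrderAt_pow (hf.meromorphic z z.2)]
  rfl

/-- The term -8k is the source of the right-hand side 8k/24 = k/3. -/
theorem IsModularFunction.meromorphicOrderAt_weightZeroExpansion (hf : IsModularFunction 7 k f) :
    meromorphicOrderAt (weightZeroExpansion k f) 0 = 24 * orderAtInfty f + ((-(k * 8) : ℤ)) := by
  have e : weightZeroExpansion k f = expansionAtInfty f ^ 24 * (thetaExpansion ^ k)⁻¹ := rfl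
  rw [e, meromorphicOrderAt_mul (hf.meromorphic_infty.pow 24)
    (meromorphicAt_thetaExpansion.zpow k).inv, meromorphicOrderAt_pow hf.meromorphic_infty,
    meromorphicOrderAt_inv, meromorphicOrderAt_zpow meromorphicAt_thetaExpansion,
    meromorphicOrderAt_thetaExpansion]
  rfl

end Expansion

/-! ### The valence formula. -/

variable {k : ℤ} {f : ℍ → ℂ}

theorem IsModularFunction.order_smul (hf : IsModularFunction 7 k f) {γ : SL(2, ℝ)}
    (hγ : γ ∈ frickeGroup 7) (z : ℍ) : order f (γ • z) = order f z :=
  order_smul_of_eventually (hf.transform γ hγ) z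

theorem IsModularFunction.orbitOrder_orbit (hf : IsModularFunction 7 k f) (z : ℍ) :
    orbitOrder 7 f (orbit 7 z) = (order f z).untop₀ := by
  obtain ⟨γ, hγ, hz⟩ := orbit_eq_orbit_iff.1 (orbit_out (orbit 7 z))
  rw [orbitOrder, ← hz, hf.order_smul hγ]

theorem IsModularFunction.order_ne_top (hf : IsModularFunction 7 k f)
    (hf0 : ¬ ∀ᶠ z in codiscrete ℍ, f z = 0) (z : ℍ) : order f z ≠ ⊤ := by
  obtain ⟨w, hw⟩ : ∃ w, order f w ≠ ⊤ := by
    by_contra! h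
    exact hf0 (eventually_codiscrete_iff.2 fun w ↦ meromorphicOrderAt_eq_top_iff.1 (h w))
  exact order_ne_top_of_exists hf.meromorphic hw z

theorem IsModularFunction.orderAtInfty_ne_top (hf : IsModularFunction 7 k f)
    (hf0 : ¬ ∀ᶠ z in codiscrete ℍ, f z = 0) : orderAtInfty f ≠ ⊤ := by
  have h : meromorphicOrderAt (weightZeroExpansion k f) 0 ≠ ⊤ :=
    hf.isInvariantPair.infty_ne_top_iff.2 fun z ↦ by
      rw [hf.order_weightZero]
      have := hf.order_ne_top hf0 z
      lift order f z to ℤ using this with n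
      exact WithTop.coe_ne_top
  intro htop
  rw [hf.meromorphicOrderAt_weightZeroExpansion, htop] at h
  exact h rfl

theorem IsModularFunction.orbitOrder_weightZero (hf : IsModularFunction 7 k f)
    (hf0 : ¬ ∀ᶠ z in codiscrete ℍ, f z = 0) (P : Orbits 7) :
    orbitOrder 7 (weightZero k f) P = 24 * orbitOrder 7 f P := by
  rw [orbitOrder, hf.order_weightZero, orbitOrder]
  have := hf.order_ne_top hf0 P.out
  lift order f P.out to ℤ using this with n
  rfl

theorem IsModularFunction.order_weightZero_ne_top (hf : IsModularFunction 7 k f)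
    (hf0 : ¬ ∀ᶠ z in codiscrete ℍ, f z = 0) (z : ℍ) : order (weightZero k f) z ≠ ⊤ := by
  rw [hf.order_weightZero]
  have := hf.order_ne_top hf0 z
  lift order f z to ℤ using this with n
  exact WithTop.coe_ne_top

theorem IsModularFunction.finite_setOf_orbitOrder_ne_zero (hf : IsModularFunction 7 k f)
    (hf0 : ¬ ∀ᶠ z in codiscrete ℍ, f z = 0) : {P : Orbits 7 | orbitOrder 7 f P ≠ 0}.Finite := by
  refine (hf.isInvariantPair.finite_setOf_orbitOrder_ne_zero
    (hf.order_weightZero_ne_top hf0)).subset fun P hP h ↦ hP ?_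
  have := hf.orbitOrder_weightZero hf0 P
  rw [orbitOrder, h] at this
  simpa using this.symm

/-- The valence formula, as a sum over all orbits with the orders of the isotropy groups. -/
theorem IsModularFunction.orderAtInfty_add_finsum (hf : IsModularFunction 7 k f)
    (hf0 : ¬ ∀ᶠ z in codiscrete ℍ, f z = 0) :
    ((orderAtInfty f).untop₀ : ℚ) +
      ∑ᶠ P : Orbits 7, 2 * (orbitOrder 7 f P : ℚ) / isotropyOrder P.out = k / 3 := by
  have h := hf.isInvariantPair.degree_eq_zero (hf.order_weightZero_ne_top hf0)
  have h1 : (meromorphicOrderAt (weightZeroExpansion k f) 0).untop₀ =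
      24 * (orderAtInfty f).untop₀ + -(k * 8) := by
    rw [hf.meromorphicOrderAt_weightZeroExpansion]
    have := hf.orderAtInfty_ne_top hf0
    lift orderAtInfty f to ℤ using this with n
    rfl
  have h2 : ∀ P : Orbits 7, 2 * (orbitOrder 7 (weightZero k f) P : ℚ) / isotropyOrder P.out =
      24 * (2 * (orbitOrder 7 f P : ℚ) / isotropyOrder P.out) := fun P ↦ by
    rw [hf.orbitOrder_weightZero hf0]
    push_cast
    ring
  rw [degree, h1, finsum_congr h2, ← mul_finsum] at h
  push_cast at h
  linarith

theorem IsModularFunction.valence_formula (hf : IsModularFunction 7 k f)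
    (hf0 : ¬ ∀ᶠ z in codiscrete ℍ, f z = 0) :
    ((orderAtInfty f).untop₀ : ℚ) + 1 / 2 * ((order f pointI).untop₀ : ℚ) +
      1 / 2 * ((order f rho1).untop₀ : ℚ) + 1 / 3 * ((order f rho2).untop₀ : ℚ) +
      ∑ᶠ P ∈ {P : Orbits 7 | P ≠ orbit 7 pointI ∧ P ≠ orbit 7 rho1 ∧ P ≠ orbit 7 rho2},
        (orbitOrder 7 f P : ℚ) = k / 3 := by
  rw [← hf.orderAtInfty_add_finsum hf0]
  set t : Orbits 7 → ℚ := fun P ↦ 2 * (orbitOrder 7 f P : ℚ) / isotropyOrder P.out with ht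
  have hfin : {P : Orbits 7 | t P ≠ 0}.Finite := by
    refine (hf.finite_setOf_orbitOrder_ne_zero hf0).subset fun P hP hP0 ↦ hP ?_
    simp [ht, hP0]
  set E : Set (Orbits 7) := {orbit 7 pointI, orbit 7 rho1, orbit 7 rho2} with hE
  have hEc : {P : Orbits 7 | P ≠ orbit 7 pointI ∧ P ≠ orbit 7 rho1 ∧ P ≠ orbit 7 rho2} = Eᶜ := by
    ext P
    simp [hE]
  -- The three exceptional orbits are distinct and have weights 2/4, 2/4, 2/6; every other orbit has
  -- weight 2/2.
  have hsplit : ∑ᶠ P, t P = ∑ᶠ P ∈ E, t P + ∑ᶠ P ∈ Eᶜ, t P := by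
    rw [← finsum_mem_univ t, ← Set.union_compl_self E]
    exact finsum_mem_union' disjoint_compl_right (hfin.subset Set.inter_subset_right)
      (hfin.subset Set.inter_subset_right)
  have hval : ∀ z : ℍ, t (orbit 7 z) = 2 * ((order f z).untop₀ : ℚ) / isotropyOrder z := fun z ↦ by
    rw [ht]
    dsimp only
    rw [hf.orbitOrder_orbit, isotropyOrder_congr (orbit_out (orbit 7 z))]
  have hsumE : ∑ᶠ P ∈ E, t P = t (orbit 7 pointI) + (t (orbit 7 rho1) + t (orbit 7 rho2)) := by
    rw [hE, finsum_mem_insert t (by simp [orbit_pointI_ne_orbit_rho1, orbit_pointI_ne_orbit_rho2])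
      (Set.toFinite _), finsum_mem_pair orbit_rho1_ne_orbit_rho2]
  have hgen : ∑ᶠ P ∈ Eᶜ, t P = ∑ᶠ P ∈ Eᶜ, (orbitOrder 7 f P : ℚ) := by
    refine finsum_mem_congr rfl fun P hP ↦ ?_
    rw [← hEc] at hP
    rw [ht]
    dsimp only
    rw [isotropyOrder_eq_two_of_orbit_ne (by rw [orbit_out]; exact hP.1)
      (by rw [orbit_out]; exact hP.2.1) (by rw [orbit_out]; exact hP.2.2)]
    push_cast
    ring
  rw [hsplit, hsumE, hEc, hgen, hval, hval, hval, isotropyOrder_pointI, isotropyOrder_rho1,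
    isotropyOrder_rho2]
  push_cast
  ring

end Fricke

theorem mainTheorem9 (k : ℤ) (f : ℍ → ℂ) (hf : Fricke.IsModularFunction 7 k f)
    (hf0 : ¬ ∀ᶠ z in codiscrete ℍ, f z = 0) :
    (∀ z : ℍ, Fricke.order f z ≠ ⊤) ∧ Fricke.orderAtInfty f ≠ ⊤ ∧
    (∀ γ ∈ Fricke.frickeGroup 7, ∀ z : ℍ, Fricke.order f (γ • z) = Fricke.order f z) ∧
    {P : Fricke.Orbits 7 | Fricke.orbitOrder 7 f P ≠ 0}.Finite ∧
    ((Fricke.orderAtInfty f).untop₀ : ℚ)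
      + 1 / 2 * ((Fricke.order f Fricke.pointI).untop₀ : ℚ)
      + 1 / 2 * ((Fricke.order f Fricke.rho1).untop₀ : ℚ)
      + 1 / 3 * ((Fricke.order f Fricke.rho2).untop₀ : ℚ)
      + ∑ᶠ P ∈ {P : Fricke.Orbits 7 | P ≠ Fricke.orbit 7 Fricke.pointI ∧
          P ≠ Fricke.orbit 7 Fricke.rho1 ∧ P ≠ Fricke.orbit 7 Fricke.rho2},
          (Fricke.orbitOrder 7 f P : ℚ)
      = (k : ℚ) / 3 :=
  ⟨hf.order_ne_top hf0, hf.orderAtInfty_ne_top hf0, fun _ hγ ↦ hf.order_smul hγ,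
    hf.finite_setOf_orbitOrder_ne_zero hf0, hf.valence_formula hf0⟩
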